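/- Let $n\ge 1$ and let $(M,\eta,\xi,\phi,g)$ be a smooth contact metric manifold of dimension $2n+1$: $g$ is a Riemannian metric on $M$, $\eta$ is a one-form such that $\eta\wedge(d\eta)^n$ vanishes nowhere, $\xi$ is a unit vector field and $\phi$ is an endomorphism field of $TM$ such that $$\eta(\xi)=1,\qquad \phi^2=-\mathrm{Id}+\eta\otimes\xi,\qquad \phi\,\xi=0,\qquad d\eta(X,Y)=2g(X,\phi Y)$$ for all tangent vectors $X,Y$. Let $Q$ be the Ricci operator of $g$, i.e. $g(QX,Y)=\mathrm{Ric}(X,Y)$. Suppose that the structure is generalized Eta-Einstein, that is, there are smooth functions $\lambda,\gamma:M\to\mathbb{R}$ such that $$QX=\lambda X+\gamma\,\eta(X)\,\xi$$ for all tangent vectors $X$. Then $$d\lambda(\xi)=0=d\gamma(\xi)\qquad\text{and}\qquad (1-2n)\,d\lambda=d\gamma .$$ If moreover $M$ is connected, then $\lambda$ is constant if and only if $\gamma$ is constant. -/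

import Mathlib

open Bundle VectorField
open scoped Manifold ContDiff

noncomputable section

namespace RiemannianGeometry

variable {E : Type*} [NormedAddCommGroup E] [NormedSpace ℝ E] [FiniteDimensional ℝ E]
  {H : Type*} [TopologicalSpace H] (I : ModelWithCorners ℝ E H)
  {M : Type*} [TopologicalSpace M] [ChartedSpace H M]
  [IsManifold I ∞ M]
  [RiemannianBundle (fun x : M ↦ TangentSpace I x)]

/-- The right-hand side of the Koszul formula: half of
`X⟨Y,Z⟩ + Y⟨X,Z⟩ - Z⟨X,Y⟩ + ⟨[X,Y],Z⟩ - ⟨[X,Z],Y⟩ - ⟨[Y,Z],X⟩`, at the point `x`. -/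
def koszul (X Y Z : Π x : M, TangentSpace I x) (x : M) : ℝ :=
  (1 / 2 : ℝ) *
    (mvfderiv I (fun y ↦ inner ℝ (Y y) (Z y)) x (X x)
      + mvfderiv I (fun y ↦ inner ℝ (X y) (Z y)) x (Y x)
      - mvfderiv I (fun y ↦ inner ℝ (X y) (Y y)) x (Z x)
      + inner ℝ (mlieBracket I X Y x) (Z x)
      - inner ℝ (mlieBracket I X Z x) (Y x)
      - inner ℝ (mlieBracket I Y Z x) (X x))

variable [IsContMDiffRiemannianBundle I 1 E (fun x : M ↦ TangentSpace I x)]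

variable {I} in
theorem mdifferentiableAt_inner {X Y : Π x : M, TangentSpace I x} {x : M}
    (hX : MDiffAt (T% X) x) (hY : MDiffAt (T% Y) x) :
    MDiffAt (fun y ↦ inner ℝ (X y) (Y y) : M → ℝ) x :=
  MDifferentiableAt.inner_bundle (E := fun x : M ↦ TangentSpace I x) (F := E) (IB := I)
    (b := fun y ↦ y) hX hY

theorem koszul_tensorial_left (Y : Π x : M, TangentSpace I x) (x : M)
    (hY : MDiffAt (T% Y) x) (Z : Π x : M, TangentSpace I x) (hZ : MDiffAt (T% Z) x) :
    TensorialAt I E (fun X ↦ koszul I X Y Z x) x where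
  smul {f X} hf hX := by
    have := FiniteDimensional.complete ℝ E
    have h1 := mvfderiv_fun_mul hf (mdifferentiableAt_inner hX hZ)
    have h2 := mvfderiv_fun_mul hf (mdifferentiableAt_inner hX hY)
    simp [koszul, mlieBracket_smul_left hf hX, inner_smul_left, inner_smul_right,
      inner_add_left, h1, h2]
    ring
  add {X X'} hX hX' := by
    have := FiniteDimensional.complete ℝ E
    have h1 := mvfderiv_fun_add (mdifferentiableAt_inner hX hZ) (mdifferentiableAt_inner hX' hZ)
    have h2 := mvfderiv_fun_add (mdifferentiableAt_inner hX hY) (mdifferentiableAt_inner hX' hY)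
    simp [koszul, mlieBracket_add_left hX hX', inner_add_left, inner_add_right, h1, h2]
    ring

theorem koszul_tensorial_right (Y : Π x : M, TangentSpace I x) (x : M)
    (hY : MDiffAt (T% Y) x) (X : Π x : M, TangentSpace I x) (hX : MDiffAt (T% X) x) :
    TensorialAt I E (fun Z ↦ koszul I X Y Z x) x where
  smul {f Z} hf hZ := by
    have := FiniteDimensional.complete ℝ E
    have h1 := mvfderiv_fun_mul hf (mdifferentiableAt_inner hX hZ)
    have h2 := mvfderiv_fun_mul hf (mdifferentiableAt_inner hY hZ)
    have h3 := real_inner_comm (X x) (Z x)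
    have h4 := real_inner_comm (Y x) (Z x)
    simp [koszul, mlieBracket_smul_right hf hZ, inner_smul_left, inner_smul_right,
      inner_add_left, h1, h2, h3, h4]
    ring
  add {Z Z'} hZ hZ' := by
    have := FiniteDimensional.complete ℝ E
    have h1 := mvfderiv_fun_add (mdifferentiableAt_inner hX hZ) (mdifferentiableAt_inner hX hZ')
    have h2 := mvfderiv_fun_add (mdifferentiableAt_inner hY hZ) (mdifferentiableAt_inner hY hZ')
    simp [koszul, mlieBracket_add_right hZ hZ', inner_add_left, inner_add_right, h1, h2]
    ring


instance (x : M) : FiniteDimensional ℝ (TangentSpace I x) :=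
  inferInstanceAs (FiniteDimensional ℝ E)

open scoped Classical in
/-- The Levi-Civita derivative `u ↦ ∇_u Y` at `x`, defined by
`⟨∇_u Y, w⟩ = koszul (U, Y, W) x` for any `U`, `W` extending `u`, `w` (see `inner_leviCivitaFun`);
it is set to `0` at points where the vector field `Y` is not differentiable. -/
def leviCivitaFun (Y : Π x : M, TangentSpace I x) (x : M) :
    TangentSpace I x →L[ℝ] TangentSpace I x :=
  if hY : MDiffAt (T% Y) x then
    letI B : TangentSpace I x →L[ℝ] TangentSpace I x →L[ℝ] ℝ :=
      TensorialAt.mkHom₂ (fun X Z ↦ koszul I X Y Z x) x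
        (koszul_tensorial_left I Y x hY) (koszul_tensorial_right I Y x hY)
    ∑ i, (B.flip (stdOrthonormalBasis ℝ (TangentSpace I x) i)).smulRight
      (stdOrthonormalBasis ℝ (TangentSpace I x) i)
  else 0

theorem inner_leviCivitaFun {X Y Z : Π x : M, TangentSpace I x} {x : M}
    (hX : MDiffAt (T% X) x) (hY : MDiffAt (T% Y) x) (hZ : MDiffAt (T% Z) x) :
    inner ℝ (leviCivitaFun I Y x (X x)) (Z x) = koszul I X Y Z x := by
  rw [leviCivitaFun, dif_pos hY]
  set B : TangentSpace I x →L[ℝ] TangentSpace I x →L[ℝ] ℝ :=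
      TensorialAt.mkHom₂ (fun X Z ↦ koszul I X Y Z x) x
        (koszul_tensorial_left I Y x hY) (koszul_tensorial_right I Y x hY) with hB
  have h : B (X x) (Z x) = koszul I X Y Z x := TensorialAt.mkHom₂_apply _ _ hX hZ
  rw [← h]
  conv_rhs => rw [← (stdOrthonormalBasis ℝ (TangentSpace I x)).sum_repr' (Z x)]
  simp [sum_inner, inner_smul_left, mul_comm]

theorem eq_of_forall_inner {x : M} {u v : TangentSpace I x}
    (h : ∀ Z : Π x : M, TangentSpace I x, MDiffAt (T% Z) x →
      (inner ℝ u (Z x) : ℝ) = inner ℝ v (Z x)) : u = v := by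
  refine ext_inner_right ℝ fun w ↦ ?_
  simpa using h (FiberBundle.extend E w) (FiberBundle.mdifferentiableAt_extend I E w)

/-- The Levi-Civita connection of a Riemannian metric on the tangent bundle. -/
def leviCivita : CovariantDerivative I E (fun x : M ↦ TangentSpace I x) where
  toFun := leviCivitaFun I
  isCovariantDerivativeOnUniv :=
  { add := by
      intro Y Y' x hY hY' _
      have := FiniteDimensional.complete ℝ E
      apply ContinuousLinearMap.ext
      intro u
      obtain ⟨X, hX, rfl⟩ : ∃ X : Π x : M, TangentSpace I x, MDiffAt (T% X) x ∧ X x = u :=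
        ⟨FiberBundle.extend E u, FiberBundle.mdifferentiableAt_extend I E u, by simp⟩
      refine eq_of_forall_inner I fun Z hZ ↦ ?_
      have h1 := mvfderiv_fun_add (mdifferentiableAt_inner hY hZ) (mdifferentiableAt_inner hY' hZ)
      have h2 := mvfderiv_fun_add (mdifferentiableAt_inner hX hY) (mdifferentiableAt_inner hX hY')
      rw [inner_leviCivitaFun I hX (mdifferentiableAt_add_section hY hY') hZ,
        add_apply, inner_add_left,
        inner_leviCivitaFun I hX hY hZ, inner_leviCivitaFun I hX hY' hZ]
      simp [koszul, mlieBracket_add_right hY hY', mlieBracket_add_left hY hY',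
        inner_add_left, inner_add_right, h1, h2]
      ring
    leibniz := by
      intro Y f x hY hf _
      have := FiniteDimensional.complete ℝ E
      apply ContinuousLinearMap.ext
      intro u
      obtain ⟨X, hX, rfl⟩ : ∃ X : Π x : M, TangentSpace I x, MDiffAt (T% X) x ∧ X x = u :=
        ⟨FiberBundle.extend E u, FiberBundle.mdifferentiableAt_extend I E u, by simp⟩
      refine eq_of_forall_inner I fun Z hZ ↦ ?_
      have h1 := mvfderiv_fun_mul hf (mdifferentiableAt_inner hY hZ)
      have h2 := mvfderiv_fun_mul hf (mdifferentiableAt_inner hX hY)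
      have h3 := real_inner_comm (X x) (Y x)
      rw [inner_leviCivitaFun I hX (hf.smul_section hY) hZ,
        add_apply, inner_add_left, smul_apply,
        inner_smul_left, inner_leviCivitaFun I hX hY hZ]
      simp [koszul, mlieBracket_smul_right hf hY, mlieBracket_smul_left hf hY,
        inner_add_left, inner_smul_left, inner_smul_right, h1, h2, h3]
      ring }

theorem leviCivita_torsion :
    haveI := FiniteDimensional.complete ℝ E
    (leviCivita I (M := M)).torsion = 0 := by
  have := FiniteDimensional.complete ℝ E
  rw [CovariantDerivative.torsion_eq_zero_iff]
  intro X Y x hX hY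
  refine eq_of_forall_inner I fun Z hZ ↦ ?_
  have h1 : inner ℝ (leviCivita I Y x (X x)) (Z x) = koszul I X Y Z x :=
    inner_leviCivitaFun I hX hY hZ
  have h2 : inner ℝ (leviCivita I X x (Y x)) (Z x) = koszul I Y X Z x :=
    inner_leviCivitaFun I hY hX hZ
  rw [inner_sub_left, h1, h2]
  have h3 : (fun y ↦ inner ℝ (Y y) (X y) : M → ℝ) = fun y ↦ inner ℝ (X y) (Y y) :=
    funext fun y ↦ real_inner_comm _ _
  rw [koszul, koszul, mlieBracket_swap_apply (V := Y) (W := X), h3, inner_neg_left]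
  ring

theorem leviCivita_metric {X Y Z : Π x : M, TangentSpace I x} {x : M}
    (hX : MDiffAt (T% X) x) (hY : MDiffAt (T% Y) x) (hZ : MDiffAt (T% Z) x) :
    mvfderiv I (fun y ↦ (inner ℝ (Y y) (Z y) : ℝ)) x (X x) =
      inner ℝ (leviCivita I Y x (X x)) (Z x) + inner ℝ (Y x) (leviCivita I Z x (X x)) := by
  have h1 : inner ℝ (leviCivita I Y x (X x)) (Z x) = koszul I X Y Z x :=
    inner_leviCivitaFun I hX hY hZ
  have h2 : inner ℝ (leviCivita I Z x (X x)) (Y x) = koszul I X Z Y x :=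
    inner_leviCivitaFun I hX hZ hY
  rw [real_inner_comm] at h2
  rw [h1, h2, koszul, koszul, mlieBracket_swap_apply (V := Z) (W := Y), inner_neg_left]
  have h3 : (fun y ↦ inner ℝ (Z y) (Y y) : M → ℝ) = fun y ↦ inner ℝ (Y y) (Z y) :=
    funext fun y ↦ real_inner_comm _ _
  rw [h3]
  ring

/-- `R(X,Y)Z = ∇_X ∇_Y Z - ∇_Y ∇_X Z - ∇_{[X,Y]} Z` for vector fields `X`, `Y`, `Z`. -/
def curvatureField (X Y Z : Π x : M, TangentSpace I x) (x : M) : TangentSpace I x :=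
  leviCivita I (fun y ↦ leviCivita I Z y (Y y)) x (X x)
    - leviCivita I (fun y ↦ leviCivita I Z y (X y)) x (Y x)
    - leviCivita I Z x (mlieBracket I X Y x)

/-- The value `R(u,v)w` of the curvature tensor on tangent vectors at `x`: the vectors are
extended to vector fields that are smooth near `x`. -/
def curvature {x : M} (u v w : TangentSpace I x) : TangentSpace I x :=
  curvatureField I (FiberBundle.extend E u) (FiberBundle.extend E v) (FiberBundle.extend E w) x

/-- The Ricci tensor `Ric(u,v)`, the trace of `w ↦ R(w,u)v`. -/
def ricci {x : M} (u v : TangentSpace I x) : ℝ :=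
  letI e := stdOrthonormalBasis ℝ (TangentSpace I x)
  ∑ i, inner ℝ (curvature I (e i) u v) (e i)

/-- The Ricci operator `Q`, given by `⟨Q u, v⟩ = Ric(u,v)`. -/
def ricciOperator {x : M} (u : TangentSpace I x) : TangentSpace I x :=
  letI e := stdOrthonormalBasis ℝ (TangentSpace I x)
  ∑ i, ricci I u (e i) • e i

end RiemannianGeometry

namespace ContactGeometry

section

variable {E : Type*} [NormedAddCommGroup E] [NormedSpace ℝ E]
  {H : Type*} [TopologicalSpace H] (I : ModelWithCorners ℝ E H)
  {M : Type*} [TopologicalSpace M] [ChartedSpace H M] [IsManifold I ∞ M]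

/-- The exterior derivative of a one-form, `dη(X,Y) = X(η(Y)) - Y(η(X)) - η([X,Y])`, on tangent
vectors `u`, `v` at `x`: these are extended to vector fields that are smooth near `x`. -/
def extDerivOneForm (η : Π x : M, TangentSpace I x →L[ℝ] ℝ) {x : M} (u v : TangentSpace I x) : ℝ :=
  mvfderiv I (fun y ↦ η y (FiberBundle.extend E v y)) x u
    - mvfderiv I (fun y ↦ η y (FiberBundle.extend E u y)) x v
    - η x (mlieBracket I (FiberBundle.extend E u) (FiberBundle.extend E v) x)

open scoped Classical in
/-- The value of `η ∧ (dη)^n` on `2n+1` tangent vectors at `x`, up to the factor `1 / 2^n`. -/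
def contactVolume (n : ℕ) (η : Π x : M, TangentSpace I x →L[ℝ] ℝ) {x : M}
    (v : Fin (2 * n + 1) → TangentSpace I x) : ℝ :=
  ∑ σ : Equiv.Perm (Fin (2 * n + 1)),
    ((Equiv.Perm.sign σ : ℤ) : ℝ) *
      (η x (v (σ 0)) *
        ∏ i : Fin n, extDerivOneForm I η (v (σ ⟨2 * i + 1, by omega⟩)) (v (σ ⟨2 * i + 2, by omega⟩)))

/-- A smooth one-form on a manifold of dimension `2n+1` is a contact form if `η ∧ (dη)^n` vanishes
nowhere. -/
structure IsContactForm (n : ℕ) (η : Π x : M, TangentSpace I x →L[ℝ] ℝ) : Prop where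
  smooth : ContMDiff I (I.prod 𝓘(ℝ, E →L[ℝ] ℝ)) ∞
    (fun x : M ↦ TotalSpace.mk' (E →L[ℝ] ℝ) (E := fun x ↦ TangentSpace I x →L[ℝ] ℝ) x (η x))
  volume_ne_zero : ∀ x : M, ∃ v : Fin (2 * n + 1) → TangentSpace I x, contactVolume I n η v ≠ 0

/-- A contact metric structure `(η, ξ, φ, g)` on the `(2n+1)`-dimensional manifold `M`, whose
Riemannian metric `g` is given by the instance `RiemannianBundle`. -/
structure ContactMetricStructure (n : ℕ) (M : Type*) [TopologicalSpace M] [ChartedSpace H M]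
    [IsManifold I ∞ M] [RiemannianBundle (fun x : M ↦ TangentSpace I x)] where
  /-- the contact form -/
  η : Π x : M, TangentSpace I x →L[ℝ] ℝ
  /-- the Reeb vector field -/
  ξ : Π x : M, TangentSpace I x
  /-- the structure endomorphism of the tangent bundle -/
  φ : Π x : M, TangentSpace I x →L[ℝ] TangentSpace I x
  isContactForm : IsContactForm I n η
  smooth_ξ : ContMDiff I (I.prod 𝓘(ℝ, E)) ∞ (fun x : M ↦ TotalSpace.mk' E x (ξ x))
  smooth_φ : ContMDiff I (I.prod 𝓘(ℝ, E →L[ℝ] E)) ∞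
    (fun x : M ↦ TotalSpace.mk' (E →L[ℝ] E)
      (E := fun x ↦ TangentSpace I x →L[ℝ] TangentSpace I x) x (φ x))
  unit_ξ : ∀ x, (inner ℝ (ξ x) (ξ x) : ℝ) = 1
  η_ξ : ∀ x, η x (ξ x) = 1
  φ_φ : ∀ x (u : TangentSpace I x), φ x (φ x u) = -u + η x u • ξ x
  φ_ξ : ∀ x, φ x (ξ x) = 0
  dη_eq : ∀ x (u v : TangentSpace I x), extDerivOneForm I η u v = 2 * inner ℝ u (φ x v)

end

end ContactGeometry

end

set_option linter.unusedSectionVars false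

noncomputable section

namespace RiemannianGeometry

section SmoothFields

open Filter Topology

variable {E : Type*} [NormedAddCommGroup E] [NormedSpace ℝ E]
  {H : Type*} [TopologicalSpace H] (I : ModelWithCorners ℝ E H)
  {M : Type*} [TopologicalSpace M] [ChartedSpace H M] [IsManifold I ∞ M]

/-- A real function is smooth on a neighbourhood of `x`. -/
def SmoothFunNear (f : M → ℝ) (x : M) : Prop :=
  ∀ᶠ y in 𝓝 x, ContMDiffAt I 𝓘(ℝ, ℝ) ∞ f y

/-- A vector field is smooth on a neighbourhood of `x`. -/
def SmoothNear (X : Π x : M, TangentSpace I x) (x : M) : Prop :=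
  ∀ᶠ y in 𝓝 x, ContMDiffAt I (I.prod 𝓘(ℝ, E)) ∞ (T% X) y

variable {I} {f g : M → ℝ} {X Y Z : Π x : M, TangentSpace I x} {x : M}

theorem SmoothFunNear.eventually (h : SmoothFunNear I f x) :
    ∀ᶠ y in 𝓝 x, SmoothFunNear I f y := eventually_eventually_nhds.2 h

theorem SmoothNear.eventually (h : SmoothNear I X x) :
    ∀ᶠ y in 𝓝 x, SmoothNear I X y := eventually_eventually_nhds.2 h

theorem SmoothFunNear.mdiff (h : SmoothFunNear I f x) : MDiffAt f x :=
  h.self_of_nhds.mdifferentiableAt (by simp)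

theorem SmoothNear.mdiff (h : SmoothNear I X x) : MDiffAt (T% X) x :=
  h.self_of_nhds.mdifferentiableAt (by simp)

theorem SmoothNear.congr (h : SmoothNear I X x) (hXY : ∀ᶠ y in 𝓝 x, Y y = X y) :
    SmoothNear I Y x := by
  filter_upwards [h, eventually_eventually_nhds.2 hXY] with y hy hy'
  refine hy.congr_of_eventuallyEq ?_
  filter_upwards [hy'] with z hz
  rw [hz]

theorem SmoothFunNear.add (hf : SmoothFunNear I f x) (hg : SmoothFunNear I g x) :
    SmoothFunNear I (fun y ↦ f y + g y) x := by
  filter_upwards [hf, hg] with y h1 h2 using h1.add h2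

theorem SmoothFunNear.sub (hf : SmoothFunNear I f x) (hg : SmoothFunNear I g x) :
    SmoothFunNear I (fun y ↦ f y - g y) x := by
  filter_upwards [hf, hg] with y h1 h2 using h1.sub h2

theorem SmoothFunNear.mul (hf : SmoothFunNear I f x) (hg : SmoothFunNear I g x) :
    SmoothFunNear I (fun y ↦ f y * g y) x := by
  filter_upwards [hf, hg] with y h1 h2 using h1.mul h2

theorem SmoothFunNear.inv (hf : SmoothFunNear I f x) (h0 : f x ≠ 0) :
    SmoothFunNear I (fun y ↦ (f y)⁻¹) x := by
  filter_upwards [hf, hf.self_of_nhds.continuousAt.eventually_ne h0] with y h1 h2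
  exact h1.inv₀ h2

theorem smoothFunNear_const (c : ℝ) : SmoothFunNear I (fun _ : M ↦ c) x :=
  Eventually.of_forall fun _ ↦ contMDiffAt_const

theorem SmoothFunNear.sum {ι : Type*} {s : Finset ι} {f : ι → M → ℝ}
    (h : ∀ i ∈ s, SmoothFunNear I (f i) x) : SmoothFunNear I (fun y ↦ ∑ i ∈ s, f i y) x := by
  filter_upwards [(eventually_all_finset s).2 h] with y hy
  exact contMDiffAt_finsetSum hy

theorem SmoothFunNear.sqrt (hf : SmoothFunNear I f x) (h0 : 0 < f x) :
    SmoothFunNear I (fun y ↦ Real.sqrt (f y)) x := by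
  filter_upwards [hf, hf.self_of_nhds.continuousAt.eventually_ne h0.ne'] with y h1 h2
  exact (Real.contDiffAt_sqrt h2).contMDiffAt.comp y h1

theorem SmoothNear.add (hX : SmoothNear I X x) (hY : SmoothNear I Y x) :
    SmoothNear I (X + Y) x := by
  filter_upwards [hX, hY] with y h1 h2 using h1.add_section h2

theorem SmoothNear.sub (hX : SmoothNear I X x) (hY : SmoothNear I Y x) :
    SmoothNear I (X - Y) x := by
  filter_upwards [hX, hY] with y h1 h2 using h1.sub_section h2

theorem SmoothNear.smul (hf : SmoothFunNear I f x) (hX : SmoothNear I X x) :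
    SmoothNear I (f • X) x := by
  filter_upwards [hf, hX] with y h1 h2 using h1.smul_section h2

theorem SmoothNear.sum {ι : Type*} {s : Finset ι} {X : ι → Π x : M, TangentSpace I x}
    (h : ∀ i ∈ s, SmoothNear I (X i) x) : SmoothNear I (fun y ↦ ∑ i ∈ s, X i y) x := by
  filter_upwards [(eventually_all_finset s).2 h] with y hy
  exact ContMDiffAt.sum_section hy

variable (I) in
theorem smoothNear_extend (u : TangentSpace I x) : SmoothNear I (FiberBundle.extend E u) x := by
  obtain ⟨s, hs, h⟩ := FiberBundle.exists_contMDiffOn_extend (k := ∞) I E u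
  filter_upwards [eventually_mem_nhds_iff.2 hs] with y hy using h.contMDiffAt hy

theorem SmoothFunNear.mvfderiv (hf : SmoothFunNear I f x) (hX : SmoothNear I X x) :
    SmoothFunNear I (fun y ↦ mvfderiv I f y (X y)) x := by
  filter_upwards [hf, hX] with y hf hX
  have h1 := hf.mfderiv_const (m := ∞) (by simp)
  have h2 := ContMDiffAt.clm_apply_of_inCoordinates h1 hX hf
  rw [contMDiffAt_totalSpace] at h2
  refine h2.2.congr_of_eventuallyEq (Eventually.of_forall fun z ↦ ?_)
  simp
  rfl

theorem SmoothNear.mlieBracket [CompleteSpace E] (hX : SmoothNear I X x)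
    (hY : SmoothNear I Y x) : SmoothNear I (mlieBracket I X Y) x := by
  have : IsManifold I (((⊤ : ℕ∞) : ℕ∞ω) + 1) M := inferInstanceAs (IsManifold I ∞ M)
  have : IsManifold I (minSmoothness ℝ 2) M := by
    simp only [minSmoothness_of_isRCLikeNormedField]; infer_instance
  filter_upwards [hX, hY] with y h1 h2
  exact ContMDiffAt.mlieBracket_vectorField (m := ⊤) (n := ⊤) h1 h2 (by simp)

theorem mvfderiv_sum {ι : Type*} {s : Finset ι} {f : ι → M → ℝ}
    (h : ∀ i ∈ s, SmoothFunNear I (f i) x) (v : TangentSpace I x) :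
    mvfderiv I (fun y ↦ ∑ i ∈ s, f i y) x v = ∑ i ∈ s, mvfderiv I (f i) x v := by
  classical
  induction s using Finset.induction_on with
  | empty => simp [mvfderiv_const]
  | insert a s ha ih =>
    have h1 : ∀ i ∈ s, SmoothFunNear I (f i) x := fun i hi ↦ h i (Finset.mem_insert_of_mem hi)
    simp only [Finset.sum_insert ha]
    rw [mvfderiv_fun_add (h a (Finset.mem_insert_self _ _)).mdiff (SmoothFunNear.sum h1).mdiff,
      add_apply, ih h1]

theorem mvfderiv_congr (h : f =ᶠ[𝓝 x] g) : mvfderiv I f x = mvfderiv I g x := by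
  simp only [mvfderiv]
  rw [h.mfderiv_eq]
  rw [h.self_of_nhds]

theorem mvfderiv_mul_apply (hf : MDiffAt f x) (hg : MDiffAt g x) (v : TangentSpace I x) :
    mvfderiv I (fun y ↦ f y * g y) x v = f x * mvfderiv I g x v + mvfderiv I f x v * g x := by
  rw [mvfderiv_fun_mul hf hg]
  simp [mul_comm]

/-- The Lie bracket acts on functions as the commutator of derivations. -/
theorem mvfderiv_mlieBracket [CompleteSpace E] (hX : SmoothNear I X x) (hY : SmoothNear I Y x)
    (hZ : SmoothNear I Z x) (hZ0 : Z x ≠ 0) (hf : SmoothFunNear I f x) :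
    mvfderiv I f x (mlieBracket I X Y x) =
      mvfderiv I (fun y ↦ mvfderiv I f y (Y y)) x (X x)
        - mvfderiv I (fun y ↦ mvfderiv I f y (X y)) x (Y x) := by
  have key {X Y : Π x : M, TangentSpace I x} (hX : SmoothNear I X x) (hY : SmoothNear I Y x) :
      mlieBracket I X (mlieBracket I Y (f • Z)) x =
        mvfderiv I (fun y ↦ mvfderiv I f y (Y y)) x (X x) • Z x
        + mvfderiv I f x (Y x) • mlieBracket I X Z x
        + mvfderiv I f x (X x) • mlieBracket I Y Z x
        + f x • mlieBracket I X (mlieBracket I Y Z) x := by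
    have e : mlieBracket I Y (f • Z) =ᶠ[𝓝 x]
        (fun y ↦ mvfderiv I f y (Y y)) • Z + f • mlieBracket I Y Z := by
      filter_upwards [hf.eventually, hZ.eventually] with y h1 h2
      exact mlieBracket_smul_right h1.mdiff h2.mdiff
    rw [EventuallyEq.mlieBracket_vectorField_eq (EventuallyEq.refl _ X) e,
      mlieBracket_add_right, mlieBracket_smul_right, mlieBracket_smul_right]
    · abel
    · exact hf.mdiff
    · exact (hY.mlieBracket hZ).mdiff
    · exact (hf.mvfderiv hY).mdiff
    · exact hZ.mdiff
    · exact (SmoothNear.smul (hf.mvfderiv hY) hZ).mdiff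
    · exact (SmoothNear.smul hf (hY.mlieBracket hZ)).mdiff
  have hM : IsManifold I (minSmoothness ℝ 3) M := by
    simp only [minSmoothness_of_isRCLikeNormedField]; infer_instance
  have c {X : Π x : M, TangentSpace I x} (hX : SmoothNear I X x) :
      ContMDiffAt I (I.prod 𝓘(ℝ, E)) (minSmoothness ℝ 2) (T% X) x :=
    hX.self_of_nhds.of_le (by simp only [minSmoothness_of_isRCLikeNormedField]; norm_cast)
  have j1 := leibniz_identity_mlieBracket_apply (c hX) (c hY) (c (SmoothNear.smul hf hZ))
  have j2 := leibniz_identity_mlieBracket_apply (c hX) (c hY) (c hZ)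
  rw [key hX hY, key hY hX, mlieBracket_smul_right hf.mdiff hZ.mdiff, j2] at j1
  have : (mvfderiv I f x (mlieBracket I X Y x) -
      (mvfderiv I (fun y ↦ mvfderiv I f y (Y y)) x (X x)
        - mvfderiv I (fun y ↦ mvfderiv I f y (X y)) x (Y x))) • Z x = 0 := by
    rw [sub_smul, sub_smul]
    rw [← sub_eq_zero] at j1
    rw [← neg_eq_zero, ← j1]
    module
  rcases smul_eq_zero.1 this with h | h
  · linarith
  · exact absurd h hZ0

theorem mlieBracket_jacobi [CompleteSpace E] (hX : SmoothNear I X x) (hY : SmoothNear I Y x)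
    (hZ : SmoothNear I Z x) :
    mlieBracket I X (mlieBracket I Y Z) x =
      mlieBracket I (mlieBracket I X Y) Z x + mlieBracket I Y (mlieBracket I X Z) x := by
  have hM : IsManifold I (minSmoothness ℝ 3) M := by
    simp only [minSmoothness_of_isRCLikeNormedField]; infer_instance
  have c {X : Π x : M, TangentSpace I x} (hX : SmoothNear I X x) :
      ContMDiffAt I (I.prod 𝓘(ℝ, E)) (minSmoothness ℝ 2) (T% X) x :=
    hX.self_of_nhds.of_le (by simp only [minSmoothness_of_isRCLikeNormedField]; norm_cast)
  exact leibniz_identity_mlieBracket_apply (c hX) (c hY) (c hZ)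

end SmoothFields

section RiemannianFields

open Filter Topology

variable {E : Type*} [NormedAddCommGroup E] [NormedSpace ℝ E] [FiniteDimensional ℝ E]
  {H : Type*} [TopologicalSpace H] {I : ModelWithCorners ℝ E H}
  {M : Type*} [TopologicalSpace M] [ChartedSpace H M] [IsManifold I ∞ M]
  [RiemannianBundle (fun x : M ↦ TangentSpace I x)]
  [IsContMDiffRiemannianBundle I ∞ E (fun x : M ↦ TangentSpace I x)]
  {f g : M → ℝ} {X Y Z W : Π x : M, TangentSpace I x} {x : M}

theorem SmoothNear.inner (hX : SmoothNear I X x) (hY : SmoothNear I Y x) :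
    SmoothFunNear I (fun y ↦ inner ℝ (X y) (Y y)) x := by
  filter_upwards [hX, hY] with y h1 h2
  exact ContMDiffAt.inner_bundle (E := fun x : M ↦ TangentSpace I x) (F := E) (IB := I)
    (b := fun y ↦ y) h1 h2

theorem smoothNear_gramSchmidt {m : ℕ} {s : Fin m → Π x : M, TangentSpace I x}
    (hs : ∀ i, SmoothNear I (s i) x) (hi : ∀ᶠ y in 𝓝 x, LinearIndependent ℝ (s · y)) (i : Fin m) :
    SmoothNear I (fun y ↦ InnerProductSpace.gramSchmidt ℝ (s · y) i) x := by
  induction i using WellFoundedLT.induction with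
  | ind i ih =>
    have h : SmoothNear I (s i - fun y ↦ ∑ j ∈ Finset.Iio i,
        ((fun y ↦ inner ℝ (InnerProductSpace.gramSchmidt ℝ (s · y) j) (s i y) *
          (inner ℝ (InnerProductSpace.gramSchmidt ℝ (s · y) j)
            (InnerProductSpace.gramSchmidt ℝ (s · y) j))⁻¹ : M → ℝ) •
          fun y ↦ InnerProductSpace.gramSchmidt ℝ (s · y) j) y) x := by
      refine (hs i).sub (SmoothNear.sum fun j hj ↦ SmoothNear.smul
        (((ih j (Finset.mem_Iio.1 hj)).inner (hs i)).mul
          (((ih j (Finset.mem_Iio.1 hj)).inner (ih j (Finset.mem_Iio.1 hj))).inv ?_))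
        (ih j (Finset.mem_Iio.1 hj)))
      rw [ne_eq, inner_self_eq_zero]
      exact InnerProductSpace.gramSchmidt_ne_zero _ hi.self_of_nhds
    refine h.congr (Eventually.of_forall fun y ↦ ?_)
    rw [InnerProductSpace.gramSchmidt_def]
    simp only [Pi.sub_apply, Pi.smul_apply', Submodule.starProjection_singleton]
    congr 1
    refine Finset.sum_congr rfl fun j _ ↦ ?_
    rw [real_inner_self_eq_norm_sq, div_eq_mul_inv]
    rfl

variable (I) in
/-- Vector fields that are smooth and orthonormal on a neighbourhood of `x`, as many as the
dimension. -/
structure IsOrthonormalFrameNear (O : Fin (Module.finrank ℝ E) → Π x : M, TangentSpace I x)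
    (x : M) : Prop where
  smooth : ∀ i, SmoothNear I (O i) x
  orthonormal : ∀ᶠ y in 𝓝 x, Orthonormal ℝ (O · y)

theorem exists_isOrthonormalFrameNear (x : M) :
    ∃ O : Fin (Module.finrank ℝ E) → Π x : M, TangentSpace I x,
      IsOrthonormalFrameNear I O x := by
  set e := trivializationAt E (TangentSpace I) x
  let b := Module.finBasis ℝ E
  have hmem : e.baseSet ∈ 𝓝 x :=
    e.open_baseSet.mem_nhds (FiberBundle.mem_baseSet_trivializationAt' x)
  have hf := e.isLocalFrameOn_localFrame_baseSet I ∞ b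
  have hs : ∀ i, SmoothNear I (e.localFrame b i) x := fun i ↦ by
    filter_upwards [hmem] with y hy
    exact hf.contMDiffAt e.open_baseSet hy i
  have hi : ∀ᶠ y in 𝓝 x, LinearIndependent ℝ (e.localFrame b · y) := by
    filter_upwards [hmem] with y hy using hf.linearIndependent hy
  have hG := smoothNear_gramSchmidt hs hi
  refine ⟨fun i y ↦ InnerProductSpace.gramSchmidtNormed ℝ (e.localFrame b · y) i, fun i ↦ ?_, ?_⟩
  · have h0 : 0 < (inner ℝ (InnerProductSpace.gramSchmidt ℝ (e.localFrame b · x) i)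
        (InnerProductSpace.gramSchmidt ℝ (e.localFrame b · x) i) : ℝ) :=
      real_inner_self_pos.2 (InnerProductSpace.gramSchmidt_ne_zero _ hi.self_of_nhds)
    refine (SmoothNear.smul ((((hG i).inner (hG i)).sqrt h0).inv (Real.sqrt_pos.2 h0).ne')
      (hG i)).congr (Eventually.of_forall fun y ↦ ?_)
    simp only [InnerProductSpace.gramSchmidtNormed, Pi.smul_apply', norm_eq_sqrt_real_inner]
    rfl
  · filter_upwards [hi] with y hy
    exact InnerProductSpace.gramSchmidtNormed_orthonormal hy

/-- An orthonormal family of tangent vectors, as many as the dimension, as an orthonormal basis. -/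
def orthonormalBasisOfFrame {x : M} {e : Fin (Module.finrank ℝ E) → TangentSpace I x}
    (h : Orthonormal ℝ e) :
    OrthonormalBasis (Fin (Module.finrank ℝ E)) ℝ (TangentSpace I x) :=
  OrthonormalBasis.mk h (by
    have : Fintype.card (Fin (Module.finrank ℝ E)) = Module.finrank ℝ (TangentSpace I x) := by
      simp; rfl
    rw [h.linearIndependent.span_eq_top_of_card_eq_finrank' this])

@[simp]
theorem orthonormalBasisOfFrame_apply {x : M} {e : Fin (Module.finrank ℝ E) → TangentSpace I x}
    (h : Orthonormal ℝ e) (i : Fin (Module.finrank ℝ E)) : orthonormalBasisOfFrame h i = e i := by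
  simp [orthonormalBasisOfFrame]

theorem sum_inner_smul_frame {x : M} {e : Fin (Module.finrank ℝ E) → TangentSpace I x}
    (h : Orthonormal ℝ e) (u : TangentSpace I x) : ∑ i, inner ℝ (e i) u • e i = u := by
  simpa using (orthonormalBasisOfFrame h).sum_repr' u

theorem sum_inner_mul_inner_frame {x : M} {e : Fin (Module.finrank ℝ E) → TangentSpace I x}
    (h : Orthonormal ℝ e) (u v : TangentSpace I x) :
    ∑ i, inner ℝ u (e i) * inner ℝ (e i) v = (inner ℝ u v : ℝ) := by
  simpa using (orthonormalBasisOfFrame h).sum_inner_mul_inner u v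

variable (I) in
/-- The vector field `∇_X Y` of the Levi-Civita connection. -/
def nabla (X Y : Π x : M, TangentSpace I x) (x : M) : TangentSpace I x :=
  leviCivita I Y x (X x)

theorem SmoothFunNear.koszul (hX : SmoothNear I X x) (hY : SmoothNear I Y x)
    (hZ : SmoothNear I Z x) : SmoothFunNear I (koszul I X Y Z) x := by
  have := FiniteDimensional.complete ℝ E
  exact (smoothFunNear_const _).mul <|
    ((((((hY.inner hZ).mvfderiv hX).add ((hX.inner hZ).mvfderiv hY)).sub
    ((hX.inner hY).mvfderiv hZ)).add ((hX.mlieBracket hY).inner hZ)).sub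
    ((hX.mlieBracket hZ).inner hY)).sub ((hY.mlieBracket hZ).inner hX)

theorem inner_nabla (hX : MDiffAt (T% X) x) (hY : MDiffAt (T% Y) x) (hZ : MDiffAt (T% Z) x) :
    inner ℝ (nabla I X Y x) (Z x) = koszul I X Y Z x :=
  inner_leviCivitaFun I hX hY hZ

theorem SmoothNear.nabla (hX : SmoothNear I X x) (hY : SmoothNear I Y x) :
    SmoothNear I (nabla I X Y) x := by
  obtain ⟨O, hO⟩ := exists_isOrthonormalFrameNear (I := I) x
  have h : SmoothNear I (fun y ↦ ∑ i, (koszul I X Y (O i) • O i) y) x :=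
    SmoothNear.sum fun i _ ↦ SmoothNear.smul (.koszul hX hY (hO.smooth i)) (hO.smooth i)
  refine h.congr ?_
  filter_upwards [hX.eventually, hY.eventually, eventually_all.2 fun i ↦ (hO.smooth i).eventually,
    hO.orthonormal] with y h1 h2 h3 h4
  rw [← sum_inner_smul_frame h4 (RiemannianGeometry.nabla I X Y y)]
  refine Finset.sum_congr rfl fun i _ ↦ ?_
  rw [real_inner_comm, inner_nabla h1.mdiff h2.mdiff (h3 i).mdiff]
  rfl

theorem nabla_add_right (hY : MDiffAt (T% Y) x) (hZ : MDiffAt (T% Z) x) :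
    nabla I X (Y + Z) x = nabla I X Y x + nabla I X Z x := by
  simp only [nabla]
  rw [(leviCivita I).isCovariantDerivativeOnUniv.add hY hZ]
  rfl

theorem nabla_smul_right (hf : MDiffAt f x) (hY : MDiffAt (T% Y) x) :
    nabla I X (f • Y) x = f x • nabla I X Y x + mvfderiv I f x (X x) • Y x := by
  simp only [nabla]
  rw [(leviCivita I).isCovariantDerivativeOnUniv.leibniz hY hf]
  rfl

theorem nabla_congr_right (hY : MDiffAt (T% Y) x) (hZ : MDiffAt (T% Z) x)
    (h : ∀ᶠ y in 𝓝 x, Y y = Z y) : nabla I X Y x = nabla I X Z x := by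
  simp only [nabla]
  rw [(leviCivita I).isCovariantDerivativeOnUniv.congr_of_eventuallyEq hY hZ univ_mem h]

theorem nabla_neg_right (hY : MDiffAt (T% Y) x) : nabla I X (-Y) x = -nabla I X Y x := by
  have h := nabla_smul_right (I := I) (X := X) (f := fun _ ↦ -1) (Y := Y)
    mdifferentiableAt_const hY
  rw [mvfderiv_const] at h
  have e : (fun _ : M ↦ (-1 : ℝ)) • Y = -Y := by
    ext y
    exact neg_one_smul ℝ (Y y)
  rw [e] at h
  simpa using h

theorem nabla_sub_right (hY : MDiffAt (T% Y) x) (hZ : MDiffAt (T% Z) x) :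
    nabla I X (Y - Z) x = nabla I X Y x - nabla I X Z x := by
  rw [sub_eq_add_neg, nabla_add_right hY (by simpa using mdifferentiableAt_neg_section hZ),
    nabla_neg_right hZ, sub_eq_add_neg]

theorem nabla_torsion (hX : MDiffAt (T% X) x) (hY : MDiffAt (T% Y) x) :
    mlieBracket I X Y x = nabla I X Y x - nabla I Y X x := by
  have := FiniteDimensional.complete ℝ E
  exact ((CovariantDerivative.torsion_eq_zero_iff _).1 (leviCivita_torsion I) hX hY).symm

theorem mvfderiv_inner (hX : MDiffAt (T% X) x) (hY : MDiffAt (T% Y) x) (hZ : MDiffAt (T% Z) x) :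
    mvfderiv I (fun y ↦ (inner ℝ (Y y) (Z y) : ℝ)) x (X x) =
      inner ℝ (nabla I X Y x) (Z x) + inner ℝ (Y x) (nabla I X Z x) :=
  leviCivita_metric I hX hY hZ

end RiemannianFields

section CurvatureTensor

open Filter Topology

variable {E : Type*} [NormedAddCommGroup E] [NormedSpace ℝ E] [FiniteDimensional ℝ E]
  {H : Type*} [TopologicalSpace H] {I : ModelWithCorners ℝ E H}
  {M : Type*} [TopologicalSpace M] [ChartedSpace H M] [IsManifold I ∞ M]
  [RiemannianBundle (fun x : M ↦ TangentSpace I x)]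
  [IsContMDiffRiemannianBundle I ∞ E (fun x : M ↦ TangentSpace I x)]
  {f g : M → ℝ} {X X' Y Y' Z Z' W V : Π x : M, TangentSpace I x} {x : M}

theorem mvfderiv_mlieBracket' (hX : SmoothNear I X x) (hY : SmoothNear I Y x)
    (hf : SmoothFunNear I f x) :
    mvfderiv I f x (mlieBracket I X Y x) =
      mvfderiv I (fun y ↦ mvfderiv I f y (Y y)) x (X x)
        - mvfderiv I (fun y ↦ mvfderiv I f y (X y)) x (Y x) := by
  have := FiniteDimensional.complete ℝ E
  by_cases h : ∃ u : TangentSpace I x, u ≠ 0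
  · obtain ⟨u, hu⟩ := h
    exact mvfderiv_mlieBracket hX hY (smoothNear_extend I u) (by simpa using hu) hf
  · push Not at h
    rw [h (mlieBracket I X Y x), h (X x), h (Y x)]
    simp

/-- A map on vector fields that is local and linear over smooth functions depends only on the
value of the vector field at the point. -/
theorem eq_of_tensorial {A : Type*} [AddCommGroup A] [Module ℝ A]
    {Φ : (Π x : M, TangentSpace I x) → A}
    (hadd : ∀ X Y, SmoothNear I X x → SmoothNear I Y x → Φ (X + Y) = Φ X + Φ Y)
    (hsmul : ∀ f X, SmoothFunNear I f x → SmoothNear I X x → Φ (f • X) = f x • Φ X)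
    (hcongr : ∀ X Y, SmoothNear I X x → SmoothNear I Y x → (∀ᶠ y in 𝓝 x, X y = Y y) → Φ X = Φ Y)
    (hX : SmoothNear I X x) (hY : SmoothNear I Y x) (hXY : X x = Y x) : Φ X = Φ Y := by
  obtain ⟨O, hO⟩ := exists_isOrthonormalFrameNear (I := I) x
  have hsum (c : Fin (Module.finrank ℝ E) → M → ℝ) (hc : ∀ i, SmoothFunNear I (c i) x)
      (s : Finset (Fin (Module.finrank ℝ E))) :
      Φ (fun y ↦ ∑ i ∈ s, (c i • O i) y) = ∑ i ∈ s, c i x • Φ (O i) := by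
    induction s using Finset.induction_on with
    | empty =>
      have h := hsmul (fun _ ↦ 0) X (smoothFunNear_const 0) hX
      have e : (fun _ : M ↦ (0 : ℝ)) • X = fun y ↦ (0 : TangentSpace I y) := by
        ext y
        exact zero_smul ℝ (X y)
      rw [e] at h
      simpa using h
    | insert a s ha ih =>
      have e : (fun y ↦ ∑ i ∈ insert a s, (c i • O i) y) =
          c a • O a + fun y ↦ ∑ i ∈ s, (c i • O i) y := by
        ext y
        simp only [Finset.sum_insert ha]
        rfl
      rw [e, hadd, hsmul _ _ (hc a) (hO.smooth a), ih, Finset.sum_insert ha]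
      · exact .smul (hc a) (hO.smooth a)
      · exact .sum fun i _ ↦ .smul (hc i) (hO.smooth i)
  have key (X : Π x : M, TangentSpace I x) (hX : SmoothNear I X x) :
      Φ X = ∑ i, (inner ℝ (O i x) (X x) : ℝ) • Φ (O i) := by
    have hc i : SmoothFunNear I (fun y ↦ inner ℝ (O i y) (X y)) x := (hO.smooth i).inner hX
    rw [← hsum (fun i y ↦ inner ℝ (O i y) (X y)) hc Finset.univ]
    refine hcongr _ _ hX (.sum fun i _ ↦ .smul (hc i) (hO.smooth i)) ?_
    filter_upwards [hO.orthonormal] with y hy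
    exact (sum_inner_smul_frame hy (X y)).symm
  rw [key X hX, key Y hY, hXY]

theorem curvatureField_eq :
    curvatureField I X Y Z x =
      nabla I X (nabla I Y Z) x - nabla I Y (nabla I X Z) x - nabla I (mlieBracket I X Y) Z x :=
  rfl

theorem nabla_add_left : nabla I (X + X') Z = nabla I X Z + nabla I X' Z := by
  ext y
  exact map_add (leviCivita I Z y) (X y) (X' y)

theorem nabla_smul_left : nabla I (f • X) Z = f • nabla I X Z := by
  ext y
  exact map_smul (leviCivita I Z y) (f y) (X y)

theorem nabla_congr_left (h : X x = X' x) : nabla I X Z x = nabla I X' Z x := by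
  rw [nabla, nabla, h]

theorem curvatureField_swap : curvatureField I X Y Z x = -curvatureField I Y X Z x := by
  have h : nabla I (mlieBracket I X Y) Z x = -nabla I (mlieBracket I Y X) Z x := by
    rw [nabla, mlieBracket_swap_apply, map_neg]
    rfl
  rw [curvatureField_eq, curvatureField_eq, h]
  abel

theorem curvatureField_add_left (hX : SmoothNear I X x) (hX' : SmoothNear I X' x)
    (hZ : SmoothNear I Z x) :
    curvatureField I (X + X') Y Z x = curvatureField I X Y Z x + curvatureField I X' Y Z x := by
  have := FiniteDimensional.complete ℝ E
  have h : nabla I (mlieBracket I (X + X') Y) Z x =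
      nabla I (mlieBracket I X Y) Z x + nabla I (mlieBracket I X' Y) Z x := by
    rw [nabla, mlieBracket_add_left hX.mdiff hX'.mdiff, map_add]
    rfl
  simp only [curvatureField_eq]
  rw [h, nabla_add_left, nabla_add_left, nabla_add_right (hX.nabla hZ).mdiff (hX'.nabla hZ).mdiff,
    Pi.add_apply]
  abel

theorem curvatureField_smul_left (hf : SmoothFunNear I f x) (hX : SmoothNear I X x)
    (hZ : SmoothNear I Z x) :
    curvatureField I (f • X) Y Z x = f x • curvatureField I X Y Z x := by
  have := FiniteDimensional.complete ℝ E
  have h : nabla I (mlieBracket I (f • X) Y) Z x =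
      -mvfderiv I f x (Y x) • nabla I X Z x + f x • nabla I (mlieBracket I X Y) Z x := by
    rw [nabla, mlieBracket_smul_left hf.mdiff hX.mdiff, map_add, map_smul, map_smul]
    rfl
  simp only [curvatureField_eq]
  rw [h, nabla_smul_left, nabla_smul_left, nabla_smul_right hf.mdiff (hX.nabla hZ).mdiff,
    Pi.smul_apply']
  module

theorem curvatureField_congr_left (hX : SmoothNear I X x) (hX' : SmoothNear I X' x)
    (hZ : SmoothNear I Z x) (h : ∀ᶠ y in 𝓝 x, X y = X' y) :
    curvatureField I X Y Z x = curvatureField I X' Y Z x := by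
  have h1 : nabla I Y (nabla I X Z) x = nabla I Y (nabla I X' Z) x :=
    nabla_congr_right (hX.nabla hZ).mdiff (hX'.nabla hZ).mdiff
      (h.mono fun y hy ↦ nabla_congr_left hy)
  have h2 : mlieBracket I X Y x = mlieBracket I X' Y x :=
    EventuallyEq.mlieBracket_vectorField_eq h (EventuallyEq.refl _ _)
  rw [curvatureField_eq, curvatureField_eq, h1, nabla_congr_left h.self_of_nhds,
    nabla_congr_left h2]

theorem nabla_add_right_eventually (hZ : SmoothNear I Z x) (hZ' : SmoothNear I Z' x) :
    ∀ᶠ y in 𝓝 x, nabla I X (Z + Z') y = (nabla I X Z + nabla I X Z') y := by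
  filter_upwards [hZ.eventually, hZ'.eventually] with y h1 h2
  exact nabla_add_right h1.mdiff h2.mdiff

theorem curvatureField_add_right (hX : SmoothNear I X x) (hY : SmoothNear I Y x)
    (hZ : SmoothNear I Z x) (hZ' : SmoothNear I Z' x) :
    curvatureField I X Y (Z + Z') x = curvatureField I X Y Z x + curvatureField I X Y Z' x := by
  have key {X Y : Π x : M, TangentSpace I x} (hY : SmoothNear I Y x) :
      nabla I X (nabla I Y (Z + Z')) x =
        nabla I X (nabla I Y Z) x + nabla I X (nabla I Y Z') x := by
    rw [nabla_congr_right (hY.nabla (hZ.add hZ')).mdiff ((hY.nabla hZ).add (hY.nabla hZ')).mdiff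
      (nabla_add_right_eventually hZ hZ'), nabla_add_right (hY.nabla hZ).mdiff (hY.nabla hZ').mdiff]
  rw [curvatureField_eq, key hX, key hY, nabla_add_right hZ.mdiff hZ'.mdiff, curvatureField_eq,
    curvatureField_eq]
  abel

theorem curvatureField_smul_right (hX : SmoothNear I X x) (hY : SmoothNear I Y x)
    (hf : SmoothFunNear I f x) (hZ : SmoothNear I Z x) :
    curvatureField I X Y (f • Z) x = f x • curvatureField I X Y Z x := by
  have key {X Y : Π x : M, TangentSpace I x} (hY : SmoothNear I Y x) :
      nabla I X (nabla I Y (f • Z)) x = f x • nabla I X (nabla I Y Z) x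
        + mvfderiv I f x (X x) • nabla I Y Z x
        + (mvfderiv I f x (Y x) • nabla I X Z x
          + mvfderiv I (fun y ↦ mvfderiv I f y (Y y)) x (X x) • Z x) := by
    have h1 := SmoothNear.smul hf (hY.nabla hZ)
    have h2 := SmoothNear.smul (hf.mvfderiv hY) hZ
    rw [nabla_congr_right (hY.nabla (SmoothNear.smul hf hZ)).mdiff (h1.add h2).mdiff,
      nabla_add_right h1.mdiff h2.mdiff, nabla_smul_right hf.mdiff (hY.nabla hZ).mdiff,
      nabla_smul_right (hf.mvfderiv hY).mdiff hZ.mdiff]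
    filter_upwards [hf.eventually, hZ.eventually] with y h1 h2
    exact nabla_smul_right h1.mdiff h2.mdiff
  rw [curvatureField_eq, key hX, key hY, nabla_smul_right hf.mdiff hZ.mdiff, curvatureField_eq,
    mvfderiv_mlieBracket' hX hY hf]
  module

theorem curvatureField_congr_right (hX : SmoothNear I X x) (hY : SmoothNear I Y x)
    (hZ : SmoothNear I Z x) (hZ' : SmoothNear I Z' x) (h : ∀ᶠ y in 𝓝 x, Z y = Z' y) :
    curvatureField I X Y Z x = curvatureField I X Y Z' x := by
  have key {X Y : Π x : M, TangentSpace I x} (hY : SmoothNear I Y x) :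
      nabla I X (nabla I Y Z) x = nabla I X (nabla I Y Z') x := by
    refine nabla_congr_right (hY.nabla hZ).mdiff (hY.nabla hZ').mdiff ?_
    filter_upwards [hZ.eventually, hZ'.eventually, eventually_eventually_nhds.2 h] with y h1 h2 h3
    exact nabla_congr_right h1.mdiff h2.mdiff h3
  rw [curvatureField_eq, curvatureField_eq, key hX, key hY, nabla_congr_right hZ.mdiff hZ'.mdiff h]

theorem curvatureField_eq_of_eq (hX : SmoothNear I X x) (hX' : SmoothNear I X' x)
    (hY : SmoothNear I Y x) (hY' : SmoothNear I Y' x)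
    (hZ : SmoothNear I Z x) (hZ' : SmoothNear I Z' x)
    (h1 : X x = X' x) (h2 : Y x = Y' x) (h3 : Z x = Z' x) :
    curvatureField I X Y Z x = curvatureField I X' Y' Z' x := by
  have key {X X' Y Z : Π x : M, TangentSpace I x} (hX : SmoothNear I X x)
      (hX' : SmoothNear I X' x) (hZ : SmoothNear I Z x) (h1 : X x = X' x) :
      curvatureField I X Y Z x = curvatureField I X' Y Z x :=
    eq_of_tensorial (Φ := fun X ↦ curvatureField I X Y Z x)
      (fun X X' hX hX' ↦ curvatureField_add_left hX hX' hZ)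
      (fun f X hf hX ↦ curvatureField_smul_left hf hX hZ)
      (fun X X' hX hX' h ↦ curvatureField_congr_left hX hX' hZ h) hX hX' h1
  rw [key hX hX' hZ h1, curvatureField_swap, key hY hY' hZ h2, ← curvatureField_swap]
  exact eq_of_tensorial (Φ := fun Z ↦ curvatureField I X' Y' Z x)
    (fun Z Z' hZ hZ' ↦ curvatureField_add_right hX' hY' hZ hZ')
    (fun f Z hf hZ ↦ curvatureField_smul_right hX' hY' hf hZ)
    (fun Z Z' hZ hZ' h ↦ curvatureField_congr_right hX' hY' hZ hZ' h) hZ hZ' h3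

theorem curvatureField_eq_curvature (hX : SmoothNear I X x) (hY : SmoothNear I Y x)
    (hZ : SmoothNear I Z x) : curvatureField I X Y Z x = curvature I (X x) (Y x) (Z x) :=
  curvatureField_eq_of_eq hX (smoothNear_extend I _) hY (smoothNear_extend I _) hZ
    (smoothNear_extend I _) (by simp) (by simp) (by simp)

theorem SmoothNear.curvatureField (hX : SmoothNear I X x) (hY : SmoothNear I Y x)
    (hZ : SmoothNear I Z x) : SmoothNear I (curvatureField I X Y Z) x := by
  have := FiniteDimensional.complete ℝ E
  exact ((hX.nabla (hY.nabla hZ)).sub (hY.nabla (hX.nabla hZ))).sub ((hX.mlieBracket hY).nabla hZ)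

theorem curvature_swap (u v w : TangentSpace I x) : curvature I u v w = -curvature I v u w :=
  curvatureField_swap

theorem curvature_add_left (u u' v w : TangentSpace I x) :
    curvature I (u + u') v w = curvature I u v w + curvature I u' v w := by
  have h (z : TangentSpace I x) := smoothNear_extend I z
  have := curvatureField_add_left (Y := FiberBundle.extend E v) (h u) (h u') (h w)
  rw [curvatureField_eq_curvature ((h u).add (h u')) (h v) (h w)] at this
  simpa [curvature] using! this

theorem curvature_smul_left (c : ℝ) (u v w : TangentSpace I x) :
    curvature I (c • u) v w = c • curvature I u v w := by
  have h (z : TangentSpace I x) := smoothNear_extend I z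
  have := curvatureField_smul_left (Y := FiberBundle.extend E v) (smoothFunNear_const c) (h u) (h w)
  rw [curvatureField_eq_curvature (.smul (smoothFunNear_const c) (h u)) (h v) (h w)] at this
  simpa [curvature] using! this

theorem curvature_add_right (u v w w' : TangentSpace I x) :
    curvature I u v (w + w') = curvature I u v w + curvature I u v w' := by
  have h (z : TangentSpace I x) := smoothNear_extend I z
  have := curvatureField_add_right (h u) (h v) (h w) (h w')
  rw [curvatureField_eq_curvature (h u) (h v) ((h w).add (h w'))] at this
  simpa [curvature] using! this

theorem curvature_smul_right (c : ℝ) (u v w : TangentSpace I x) :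
    curvature I u v (c • w) = c • curvature I u v w := by
  have h (z : TangentSpace I x) := smoothNear_extend I z
  have := curvatureField_smul_right (h u) (h v) (smoothFunNear_const c) (h w)
  rw [curvatureField_eq_curvature (h u) (h v) (.smul (smoothFunNear_const c) (h w))] at this
  simpa [curvature] using! this

variable (I) in
/-- The endomorphism `w ↦ R(w,u)v` whose trace is the Ricci tensor. -/
def curvatureLeft {x : M} (u v : TangentSpace I x) : TangentSpace I x →ₗ[ℝ] TangentSpace I x where
  toFun w := curvature I w u v
  map_add' w w' := curvature_add_left w w' u v
  map_smul' c w := curvature_smul_left c w u v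

@[simp]
theorem curvatureLeft_apply (u v w : TangentSpace I x) :
    curvatureLeft I u v w = curvature I w u v := rfl

theorem inner_curvatureField (hX : SmoothNear I X x) (hY : SmoothNear I Y x)
    (hZ : SmoothNear I Z x) (hW : SmoothNear I W x) :
    inner ℝ (curvatureField I X Y Z x) (W x) + inner ℝ (Z x) (curvatureField I X Y W x)
      = (0 : ℝ) := by
  have := FiniteDimensional.complete ℝ E
  have h1 {X Y : Π x : M, TangentSpace I x} (hX : SmoothNear I X x) (hY : SmoothNear I Y x) :
      mvfderiv I (fun y ↦ mvfderiv I (fun y ↦ (inner ℝ (Z y) (W y) : ℝ)) y (Y y)) x (X x) =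
        inner ℝ (nabla I X (nabla I Y Z) x) (W x) + inner ℝ (nabla I Y Z x) (nabla I X W x)
        + (inner ℝ (nabla I X Z x) (nabla I Y W x) + inner ℝ (Z x) (nabla I X (nabla I Y W) x)) := by
    have e : (fun y ↦ mvfderiv I (fun y ↦ (inner ℝ (Z y) (W y) : ℝ)) y (Y y)) =ᶠ[𝓝 x]
        fun y ↦ inner ℝ (nabla I Y Z y) (W y) + inner ℝ (Z y) (nabla I Y W y) := by
      filter_upwards [hY.eventually, hZ.eventually, hW.eventually] with y h1 h2 h3
      exact mvfderiv_inner h1.mdiff h2.mdiff h3.mdiff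
    rw [mvfderiv_congr e, mvfderiv_fun_add ((hY.nabla hZ).inner hW).mdiff
      (hZ.inner (hY.nabla hW)).mdiff, add_apply,
      mvfderiv_inner hX.mdiff (hY.nabla hZ).mdiff hW.mdiff,
      mvfderiv_inner hX.mdiff hZ.mdiff (hY.nabla hW).mdiff]
  have h2 := mvfderiv_mlieBracket' hX hY (hZ.inner hW)
  rw [h1 hX hY, h1 hY hX, mvfderiv_inner (hX.mlieBracket hY).mdiff hZ.mdiff hW.mdiff] at h2
  rw [curvatureField_eq, curvatureField_eq]
  simp only [inner_sub_left, inner_sub_right]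
  linarith

theorem ricci_eq_sum_frame {e : Fin (Module.finrank ℝ E) → TangentSpace I x}
    (h : Orthonormal ℝ e) (u v : TangentSpace I x) :
    ricci I u v = ∑ i, (inner ℝ (curvature I (e i) u v) (e i) : ℝ) := by
  have h1 := (curvatureLeft I u v).trace_eq_sum_inner (stdOrthonormalBasis ℝ (TangentSpace I x))
  have h2 := (curvatureLeft I u v).trace_eq_sum_inner (orthonormalBasisOfFrame h)
  rw [h1] at h2
  simp only [orthonormalBasisOfFrame_apply, curvatureLeft_apply] at h2
  simp only [ricci]
  simpa only [real_inner_comm] using h2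

theorem inner_ricciOperator (u v : TangentSpace I x) :
    inner ℝ (ricciOperator I u) v = ricci I u v := by
  have hlin : ∃ L : TangentSpace I x →ₗ[ℝ] ℝ, ∀ v, L v = ricci I u v :=
    ⟨{ toFun := ricci I u
       map_add' := fun v v' ↦ by
        simp [ricci, curvature_add_right, inner_add_left, Finset.sum_add_distrib]
       map_smul' := fun c v ↦ by
        simp [ricci, curvature_smul_right, inner_smul_left, Finset.mul_sum] }, fun _ ↦ rfl⟩
  obtain ⟨L, hL⟩ := hlin
  have h := congrArg L ((stdOrthonormalBasis ℝ (TangentSpace I x)).sum_repr' v)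
  rw [map_sum] at h
  simp_rw [map_smul, hL] at h
  rw [← h]
  simp [ricciOperator, sum_inner, inner_smul_left, mul_comm]

end CurvatureTensor

section Bianchi

open Filter Topology

variable {E : Type*} [NormedAddCommGroup E] [NormedSpace ℝ E] [FiniteDimensional ℝ E]
  {H : Type*} [TopologicalSpace H] {I : ModelWithCorners ℝ E H}
  {M : Type*} [TopologicalSpace M] [ChartedSpace H M] [IsManifold I ∞ M]
  [RiemannianBundle (fun x : M ↦ TangentSpace I x)]
  [IsContMDiffRiemannianBundle I ∞ E (fun x : M ↦ TangentSpace I x)]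
  {X Y Z W V : Π x : M, TangentSpace I x} {x : M}

variable (I) in
/-- The value `(∇_X R)(Y,Z)W` of the covariant derivative of the curvature tensor. -/
def nablaCurvature (X Y Z W : Π x : M, TangentSpace I x) (x : M) : TangentSpace I x :=
  nabla I X (curvatureField I Y Z W) x - curvatureField I (nabla I X Y) Z W x
    - curvatureField I Y (nabla I X Z) W x - curvatureField I Y Z (nabla I X W) x

variable (I) in
/-- The value `(∇_X Ric)(Y,Z)` of the covariant derivative of the Ricci tensor. -/
def nablaRicci (X Y Z : Π x : M, TangentSpace I x) (x : M) : ℝ :=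
  mvfderiv I (fun y ↦ ricci I (Y y) (Z y)) x (X x) - ricci I (nabla I X Y x) (Z x)
    - ricci I (Y x) (nabla I X Z x)

theorem nablaCurvature_swap (hY : SmoothNear I Y x) (hZ : SmoothNear I Z x)
    (hW : SmoothNear I W x) :
    nablaCurvature I X Y Z W x = -nablaCurvature I X Z Y W x := by
  have e : curvatureField I Y Z W = -curvatureField I Z Y W := by
    ext y
    exact curvatureField_swap
  rw [nablaCurvature, nablaCurvature, e, nabla_neg_right (hZ.curvatureField hY hW).mdiff,
    curvatureField_swap (Y := Z), curvatureField_swap (X := Y) (Y := nabla I X Z),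
    curvatureField_swap (X := Y)]
  abel

theorem inner_nablaCurvature (hX : SmoothNear I X x) (hY : SmoothNear I Y x)
    (hZ : SmoothNear I Z x) (hW : SmoothNear I W x) (hV : SmoothNear I V x) :
    inner ℝ (nablaCurvature I X Y Z W x) (V x) =
      -(inner ℝ (nablaCurvature I X Y Z V x) (W x) : ℝ) := by
  have e : (fun y ↦ inner ℝ (curvatureField I Y Z W y) (V y) +
      inner ℝ (W y) (curvatureField I Y Z V y)) =ᶠ[𝓝 x] fun _ ↦ (0 : ℝ) := by
    filter_upwards [hY.eventually, hZ.eventually, hW.eventually, hV.eventually] with y h1 h2 h3 h4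
    exact inner_curvatureField h1 h2 h3 h4
  have h := congrArg (fun L ↦ L (X x)) (mvfderiv_congr (I := I) e)
  have hW' := hY.curvatureField hZ hW
  have hV' := hY.curvatureField hZ hV
  simp only [mvfderiv_const] at h
  rw [mvfderiv_fun_add (hW'.inner hV).mdiff (hW.inner hV').mdiff, add_apply,
    mvfderiv_inner hX.mdiff hW'.mdiff hV.mdiff, mvfderiv_inner hX.mdiff hW.mdiff hV'.mdiff] at h
  have h1 := inner_curvatureField (hX.nabla hY) hZ hW hV
  have h2 := inner_curvatureField hY (hX.nabla hZ) hW hV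
  have h3 := inner_curvatureField hY hZ (hX.nabla hW) hV
  have h4 := inner_curvatureField hY hZ hW (hX.nabla hV)
  simp only [nablaCurvature, inner_sub_left]
  simp only [real_inner_comm (W x), zero_apply] at *
  linarith

theorem secondBianchi (hX : SmoothNear I X x) (hY : SmoothNear I Y x) (hZ : SmoothNear I Z x)
    (hW : SmoothNear I W x) :
    nablaCurvature I X Y Z W x + nablaCurvature I Y Z X W x + nablaCurvature I Z X Y W x = 0 := by
  have := FiniteDimensional.complete ℝ E
  have h1 {X Y Z : Π x : M, TangentSpace I x} (hX : SmoothNear I X x) (hY : SmoothNear I Y x)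
      (hZ : SmoothNear I Z x) :
      nabla I X (curvatureField I Y Z W) x = nabla I X (nabla I Y (nabla I Z W)) x
        - nabla I X (nabla I Z (nabla I Y W)) x - nabla I X (nabla I (mlieBracket I Y Z) W) x := by
    have e : curvatureField I Y Z W =
        nabla I Y (nabla I Z W) - nabla I Z (nabla I Y W) - nabla I (mlieBracket I Y Z) W := rfl
    have a := hY.nabla (hZ.nabla hW)
    have b := hZ.nabla (hY.nabla hW)
    rw [e, nabla_sub_right (a.sub b).mdiff ((hY.mlieBracket hZ).nabla hW).mdiff,
      nabla_sub_right a.mdiff b.mdiff]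
  have h2 {X Y Z : Π x : M, TangentSpace I x} (hX : SmoothNear I X x) (hY : SmoothNear I Y x)
      (hZ : SmoothNear I Z x) :
      nabla I (mlieBracket I X Y) (nabla I Z W) x - nabla I Z (nabla I (mlieBracket I X Y) W) x
        = curvature I (nabla I X Y x) (Z x) (W x) - curvature I (nabla I Y X x) (Z x) (W x)
          + leviCivita I W x (mlieBracket I (mlieBracket I X Y) Z x) := by
    have e := curvatureField_eq (I := I) (X := mlieBracket I X Y) (Y := Z) (Z := W) (x := x)
    rw [curvatureField_eq_curvature (hX.mlieBracket hY) hZ hW, nabla_torsion hX.mdiff hY.mdiff,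
      sub_eq_add_neg, curvature_add_left, ← neg_one_smul ℝ, curvature_smul_left] at e
    have e2 : nabla I (mlieBracket I (mlieBracket I X Y) Z) W x =
      leviCivita I W x (mlieBracket I (mlieBracket I X Y) Z x) := rfl
    rw [e2] at e
    rw [← sub_eq_zero] at e ⊢
    rw [← neg_eq_zero, ← e]
    module
  have j := congrArg (leviCivita I W x) (mlieBracket_jacobi hX hY hZ)
  have s1 : mlieBracket I X (mlieBracket I Y Z) x = -mlieBracket I (mlieBracket I Y Z) X x :=
    mlieBracket_swap_apply
  have s2 : mlieBracket I Y (mlieBracket I X Z) x = mlieBracket I (mlieBracket I Z X) Y x := by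
    rw [mlieBracket_swap_apply, mlieBracket_swap (V := X)]
    have : mlieBracket I (-mlieBracket I Z X) Y x =
        mlieBracket I ((-1 : ℝ) • mlieBracket I Z X) Y x := by rw [neg_one_smul]
    rw [this, mlieBracket_const_smul_left (hZ.mlieBracket hX).mdiff]
    module
  rw [s1, s2, map_neg, map_add, eq_comm] at j
  have a1 := h2 hX hY hZ
  have a2 := h2 hY hZ hX
  have a3 := h2 hZ hX hY
  simp only [nablaCurvature]
  rw [h1 hX hY hZ, h1 hY hZ hX, h1 hZ hX hY, curvatureField_eq (Z := nabla I X W),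
    curvatureField_eq (Z := nabla I Y W), curvatureField_eq (Z := nabla I Z W),
    curvatureField_eq_curvature (hX.nabla hY) hZ hW,
    curvatureField_eq_curvature hY (hX.nabla hZ) hW,
    curvatureField_eq_curvature (hY.nabla hZ) hX hW,
    curvatureField_eq_curvature hZ (hY.nabla hX) hW,
    curvatureField_eq_curvature (hZ.nabla hX) hY hW,
    curvatureField_eq_curvature hX (hZ.nabla hY) hW,
    curvature_swap (Y x), curvature_swap (Z x), curvature_swap (X x)]
  rw [← sub_eq_zero] at a1 a2 a3 j
  have t := congrArg₂ (· + ·) (congrArg₂ (· + ·) (congrArg₂ (· + ·) a1 a2) a3) j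
  simp only [add_zero] at t
  rw [← t]
  module

/-- The connection coefficients of an orthonormal frame are antisymmetric. -/
theorem sum_inner_nabla_frame {O : Fin (Module.finrank ℝ E) → Π x : M, TangentSpace I x}
    (hO : IsOrthonormalFrameNear I O x) (hX : SmoothNear I X x)
    (L : TangentSpace I x →ₗ[ℝ] TangentSpace I x) :
    ∑ i, (inner ℝ (L (nabla I X (O i) x)) (O i x) + inner ℝ (L (O i x)) (nabla I X (O i) x))
      = (0 : ℝ) := by
  have ho := hO.orthonormal.self_of_nhds
  have anti (i j) : (inner ℝ (O j x) (nabla I X (O i) x) : ℝ)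
      = -inner ℝ (O i x) (nabla I X (O j) x) := by
    have e : (fun y ↦ (inner ℝ (O i y) (O j y) : ℝ)) =ᶠ[𝓝 x] fun _ ↦ if i = j then 1 else 0 := by
      filter_upwards [hO.orthonormal] with y hy
      exact orthonormal_iff_ite.1 hy i j
    have h := mvfderiv_inner hX.mdiff (hO.smooth i).mdiff (hO.smooth j).mdiff
    rw [mvfderiv_congr e, mvfderiv_const, zero_apply] at h
    rw [real_inner_comm]
    linarith
  have e1 (i) : (inner ℝ (L (nabla I X (O i) x)) (O i x) : ℝ) =
      ∑ j, inner ℝ (O j x) (nabla I X (O i) x) * inner ℝ (L (O j x)) (O i x) := by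
    conv_lhs => rw [← sum_inner_smul_frame ho (nabla I X (O i) x)]
    simp [map_sum, sum_inner, inner_smul_left]
  have e2 (i) : (inner ℝ (L (O i x)) (nabla I X (O i) x) : ℝ) =
      ∑ j, inner ℝ (O j x) (nabla I X (O i) x) * inner ℝ (L (O i x)) (O j x) := by
    rw [← sum_inner_mul_inner_frame ho]
    exact Finset.sum_congr rfl fun j _ ↦ mul_comm _ _
  rw [Finset.sum_add_distrib, Finset.sum_congr rfl fun i _ ↦ e1 i,
    Finset.sum_congr rfl fun i _ ↦ e2 i, Finset.sum_comm, ← Finset.sum_add_distrib]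
  refine Finset.sum_eq_zero fun i _ ↦ ?_
  rw [← Finset.sum_add_distrib]
  refine Finset.sum_eq_zero fun j _ ↦ ?_
  rw [anti i j]
  ring

theorem nablaRicci_eq_sum {O : Fin (Module.finrank ℝ E) → Π x : M, TangentSpace I x}
    (hO : IsOrthonormalFrameNear I O x) (hX : SmoothNear I X x) (hY : SmoothNear I Y x)
    (hZ : SmoothNear I Z x) :
    nablaRicci I X Y Z x = ∑ i, (inner ℝ (nablaCurvature I X (O i) Y Z x) (O i x) : ℝ) := by
  have ho := hO.orthonormal.self_of_nhds
  have e : (fun y ↦ ricci I (Y y) (Z y)) =ᶠ[𝓝 x]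
      fun y ↦ ∑ i, (inner ℝ (curvatureField I (O i) Y Z y) (O i y) : ℝ) := by
    filter_upwards [hO.orthonormal, hY.eventually, hZ.eventually,
      eventually_all.2 fun i ↦ (hO.smooth i).eventually] with y h1 h2 h3 h4
    rw [ricci_eq_sum_frame h1]
    exact Finset.sum_congr rfl fun i _ ↦ by rw [curvatureField_eq_curvature (h4 i) h2 h3]
  have hs i : SmoothNear I (curvatureField I (O i) Y Z) x := (hO.smooth i).curvatureField hY hZ
  have h0 := sum_inner_nabla_frame hO hX (curvatureLeft I (Y x) (Z x))
  rw [nablaRicci, mvfderiv_congr e, mvfderiv_sum fun i _ ↦ (hs i).inner (hO.smooth i),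
    ricci_eq_sum_frame ho, ricci_eq_sum_frame ho, ← Finset.sum_sub_distrib,
    ← Finset.sum_sub_distrib, ← sub_eq_zero, ← Finset.sum_sub_distrib, ← h0]
  refine Finset.sum_congr rfl fun i _ ↦ ?_
  rw [mvfderiv_inner hX.mdiff (hs i).mdiff (hO.smooth i).mdiff]
  simp only [nablaCurvature, inner_sub_left, curvatureLeft_apply]
  rw [curvatureField_eq_curvature (hX.nabla (hO.smooth i)) hY hZ,
    curvatureField_eq_curvature (hO.smooth i) (hX.nabla hY) hZ,
    curvatureField_eq_curvature (hO.smooth i) hY (hX.nabla hZ),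
    curvatureField_eq_curvature (hO.smooth i) hY hZ]
  ring

theorem contractedBianchi {O : Fin (Module.finrank ℝ E) → Π x : M, TangentSpace I x}
    (hO : IsOrthonormalFrameNear I O x) (hX : SmoothNear I X x) :
    ∑ i, nablaRicci I X (O i) (O i) x = 2 * ∑ i, nablaRicci I (O i) X (O i) x := by
  have h i j : (inner ℝ (nablaCurvature I X (O i) (O j) (O j) x) (O i x) : ℝ)
      = inner ℝ (nablaCurvature I (O i) (O j) X (O i) x) (O j x)
        + inner ℝ (nablaCurvature I (O j) (O i) X (O j) x) (O i x) := by
    have b := congrArg (fun u ↦ (inner ℝ u (O i x) : ℝ))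
      (secondBianchi hX (hO.smooth i) (hO.smooth j) (hO.smooth j))
    simp only [inner_add_left, inner_zero_left] at b
    rw [inner_nablaCurvature (hO.smooth i) (hO.smooth j) hX (hO.smooth j) (hO.smooth i),
      nablaCurvature_swap hX (hO.smooth i) (hO.smooth j), inner_neg_left] at b
    linarith
  have h1 j : nablaRicci I X (O j) (O j) x = ∑ i,
      ((inner ℝ (nablaCurvature I (O i) (O j) X (O i) x) (O j x) : ℝ)
        + inner ℝ (nablaCurvature I (O j) (O i) X (O j) x) (O i x)) := by
    rw [nablaRicci_eq_sum hO hX (hO.smooth j) (hO.smooth j)]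
    exact Finset.sum_congr rfl fun i _ ↦ h i j
  simp only [h1, Finset.sum_add_distrib]
  rw [Finset.sum_comm, two_mul]
  congr 1 <;>
  exact Finset.sum_congr rfl fun i _ ↦ (nablaRicci_eq_sum hO (hO.smooth i) hX (hO.smooth i)).symm

end Bianchi

section LocallyConstant

open Filter Topology

variable {E : Type*} [NormedAddCommGroup E] [NormedSpace ℝ E]
  {M : Type*} [TopologicalSpace M] [ChartedSpace E M] [IsManifold 𝓘(ℝ, E) ∞ M]

theorem isLocallyConstant_of_mvfderiv_eq_zero {f : M → ℝ}
    (hf : ContMDiff 𝓘(ℝ, E) 𝓘(ℝ, ℝ) ∞ f) (h : ∀ x, mvfderiv 𝓘(ℝ, E) f x = 0) :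
    IsLocallyConstant f := by
  rw [IsLocallyConstant.iff_eventually_eq]
  intro x
  set e := chartAt E x
  obtain ⟨r, hr, hball⟩ := Metric.isOpen_iff.1 e.open_target (e x) (mem_chart_target E x)
  have hd : ∀ z ∈ Metric.ball (e x) r, HasFDerivAt (f ∘ e.symm) (0 : E →L[ℝ] ℝ) z := fun z hz ↦ by
    have h1 : MDifferentiableAt 𝓘(ℝ, E) 𝓘(ℝ, E) e.symm z :=
      mdifferentiableAt_atlas_symm (chart_mem_atlas E x) (hball hz)
    have h2 : MDiffAt f (e.symm z) := hf.mdifferentiable (by simp) _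
    have h3 : mfderiv 𝓘(ℝ, E) 𝓘(ℝ, ℝ) f (e.symm z) = 0 := by
      ext v
      exact congrArg (fun L ↦ L v) (h (e.symm z))
    have h4 := h2.hasMFDerivAt.comp z h1.hasMFDerivAt
    rw [h3] at h4
    exact (hasMFDerivAt_iff_hasFDerivAt.1 h4).congr_fderiv (ContinuousLinearMap.zero_comp _)
  have hc : ∀ z ∈ Metric.ball (e x) r, (f ∘ e.symm) z = (f ∘ e.symm) (e x) := fun z hz ↦
    Metric.isOpen_ball.is_const_of_fderiv_eq_zero (convex_ball _ _).isPreconnected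
      (fun w hw ↦ (hd w hw).differentiableAt.differentiableWithinAt)
      (fun w hw ↦ (hd w hw).fderiv) hz (Metric.mem_ball_self hr)
  have hn : ∀ᶠ y in 𝓝 x, e y ∈ Metric.ball (e x) r :=
    (e.continuousAt (mem_chart_source E x)).eventually (Metric.ball_mem_nhds _ hr)
  filter_upwards [hn, e.open_source.mem_nhds (mem_chart_source E x)] with y hy hy'
  have := hc (e y) hy
  simpa [e.left_inv hy', e.left_inv (mem_chart_source E x)] using this

theorem exists_eq_const_of_mvfderiv_eq_zero [ConnectedSpace M] {f : M → ℝ}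
    (hf : ContMDiff 𝓘(ℝ, E) 𝓘(ℝ, ℝ) ∞ f) (h : ∀ x, mvfderiv 𝓘(ℝ, E) f x = 0) :
    ∃ c, ∀ x, f x = c := by
  obtain ⟨x⟩ := (inferInstance : Nonempty M)
  exact ⟨f x, fun y ↦
    (isLocallyConstant_of_mvfderiv_eq_zero hf h).apply_eq_of_preconnectedSpace _ _⟩

end LocallyConstant

end RiemannianGeometry

namespace ContactGeometry

open Filter Topology RiemannianGeometry

section

variable {E : Type*} [NormedAddCommGroup E] [NormedSpace ℝ E]
  {H : Type*} [TopologicalSpace H] {I : ModelWithCorners ℝ E H}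
  {M : Type*} [TopologicalSpace M] [ChartedSpace H M] [IsManifold I ∞ M]

theorem extDerivOneForm_swap (η : Π x : M, TangentSpace I x →L[ℝ] ℝ) {x : M}
    (u v : TangentSpace I x) : extDerivOneForm I η u v = -extDerivOneForm I η v u := by
  rw [extDerivOneForm, extDerivOneForm, mlieBracket_swap_apply, map_neg]
  ring

end

namespace ContactMetricStructure

variable {E : Type*} [NormedAddCommGroup E] [NormedSpace ℝ E] [FiniteDimensional ℝ E]
  {H : Type*} [TopologicalSpace H] {I : ModelWithCorners ℝ E H}
  {M : Type*} [TopologicalSpace M] [ChartedSpace H M] [IsManifold I ∞ M]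
  [RiemannianBundle (fun x : M ↦ TangentSpace I x)]
  {n : ℕ} (S : ContactMetricStructure I n M) {X Y Z : Π x : M, TangentSpace I x} {x : M}

theorem inner_φ_right (u v : TangentSpace I x) :
    (inner ℝ u (S.φ x v) : ℝ) = -inner ℝ (S.φ x u) v := by
  have h := extDerivOneForm_swap S.η u v
  rw [S.dη_eq, S.dη_eq] at h
  rw [real_inner_comm v]
  linarith

theorem inner_ξ_φ (u : TangentSpace I x) : (inner ℝ (S.ξ x) (S.φ x u) : ℝ) = 0 := by
  rw [S.inner_φ_right, S.φ_ξ, inner_zero_left, neg_zero]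

theorem η_eq_inner (u : TangentSpace I x) : S.η x u = inner ℝ (S.ξ x) u := by
  have h := S.inner_ξ_φ (S.φ x u)
  rw [S.φ_φ, inner_add_right, inner_neg_right, inner_smul_right, S.unit_ξ] at h
  linarith

theorem inner_φ_φ (u : TangentSpace I x) :
    (inner ℝ (S.φ x u) (S.φ x u) : ℝ) =
      inner ℝ u u - inner ℝ (S.ξ x) u * inner ℝ (S.ξ x) u := by
  have h := S.inner_φ_right u (S.φ x u)
  rw [S.φ_φ, inner_add_right, inner_neg_right, inner_smul_right, S.η_eq_inner,
    real_inner_comm (S.ξ x) u] at h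
  linarith

theorem smoothNear_ξ (x : M) : SmoothNear I S.ξ x := Eventually.of_forall fun y ↦ S.smooth_ξ y

theorem smoothNear_φ (hX : SmoothNear I X x) : SmoothNear I (fun y ↦ S.φ y (X y)) x := by
  filter_upwards [hX] with y hy
  exact ContMDiffAt.clm_bundle_apply (F₁ := E) (F₂ := E) (E₁ := fun x : M ↦ TangentSpace I x)
    (E₂ := fun x : M ↦ TangentSpace I x) (b := fun y ↦ y) (S.smooth_φ y) hy

variable [IsContMDiffRiemannianBundle I ∞ E (fun x : M ↦ TangentSpace I x)]

/-- The endomorphism `u ↦ ∇_u ξ`. -/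
def nablaξ (x : M) : TangentSpace I x →L[ℝ] TangentSpace I x := leviCivita I S.ξ x

theorem nabla_ξ : nabla I X S.ξ x = S.nablaξ x (X x) := rfl

theorem mvfderiv_inner_ξ_sub (hX : SmoothNear I X x) (hY : SmoothNear I Y x) :
    mvfderiv I (fun y ↦ (inner ℝ (S.ξ y) (Y y) : ℝ)) x (X x)
      - mvfderiv I (fun y ↦ (inner ℝ (S.ξ y) (X y) : ℝ)) x (Y x)
      - inner ℝ (S.ξ x) (mlieBracket I X Y x)
      = inner ℝ (S.nablaξ x (X x)) (Y x) - inner ℝ (S.nablaξ x (Y x)) (X x) := by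
  have hξ := (S.smoothNear_ξ x).mdiff
  rw [mvfderiv_inner hX.mdiff hξ hY.mdiff, mvfderiv_inner hY.mdiff hξ hX.mdiff,
    nabla_torsion hX.mdiff hY.mdiff, inner_sub_right]
  simp only [S.nabla_ξ]
  ring

theorem inner_nablaξ_sub (u v : TangentSpace I x) :
    (inner ℝ (S.nablaξ x u) v - inner ℝ (S.nablaξ x v) u : ℝ) = 2 * inner ℝ u (S.φ x v) := by
  have h := S.mvfderiv_inner_ξ_sub (smoothNear_extend I u) (smoothNear_extend I v)
  rw [← S.dη_eq, extDerivOneForm]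
  simp only [S.η_eq_inner]
  simpa using h.symm

theorem two_mul_inner_φ (hX : SmoothNear I X x) (hY : SmoothNear I Y x) :
    2 * inner ℝ (X x) (S.φ x (Y x)) =
      mvfderiv I (fun y ↦ (inner ℝ (S.ξ y) (Y y) : ℝ)) x (X x)
      - mvfderiv I (fun y ↦ (inner ℝ (S.ξ y) (X y) : ℝ)) x (Y x)
      - inner ℝ (S.ξ x) (mlieBracket I X Y x) := by
  rw [S.mvfderiv_inner_ξ_sub hX hY, S.inner_nablaξ_sub]

theorem inner_nablaξ_ξ (u : TangentSpace I x) : (inner ℝ (S.nablaξ x u) (S.ξ x) : ℝ) = 0 := by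
  have hu := smoothNear_extend I u
  have hξ := (S.smoothNear_ξ x).mdiff
  have h := mvfderiv_inner hu.mdiff hξ hξ
  simp only [S.unit_ξ, mvfderiv_const, zero_apply, S.nabla_ξ] at h
  rw [real_inner_comm (S.nablaξ x _) (S.ξ x)] at h
  have e : FiberBundle.extend E u x = u := by simp
  rw [e] at h
  linarith

theorem nablaξ_ξ : S.nablaξ x (S.ξ x) = 0 := by
  refine ext_inner_right ℝ fun v ↦ ?_
  have h := S.inner_nablaξ_sub (S.ξ x) v
  rw [S.inner_nablaξ_ξ, S.inner_ξ_φ] at h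
  rw [inner_zero_left]
  linarith

theorem mvfderiv_ξ_inner_ξ (hX : SmoothNear I X x) :
    mvfderiv I (fun y ↦ (inner ℝ (S.ξ y) (X y) : ℝ)) x (S.ξ x) =
      inner ℝ (S.ξ x) (mlieBracket I S.ξ X x) := by
  have h := S.two_mul_inner_φ (S.smoothNear_ξ x) hX
  simp only [S.unit_ξ, mvfderiv_const, zero_apply, S.inner_ξ_φ] at h
  linarith

/-- The two-form `dη` is invariant under the flow of the Reeb vector field. -/
theorem lieDerivative_dη (hX : SmoothNear I X x) (hY : SmoothNear I Y x) :
    mvfderiv I (fun y ↦ (inner ℝ (X y) (S.φ y (Y y)) : ℝ)) x (S.ξ x) =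
      inner ℝ (mlieBracket I S.ξ X x) (S.φ x (Y x))
        + inner ℝ (X x) (S.φ x (mlieBracket I S.ξ Y x)) := by
  have := FiniteDimensional.complete ℝ E
  have hξ := S.smoothNear_ξ x
  have hXY := hX.mlieBracket hY
  have hfX := hξ.inner hX
  have hfY := hξ.inner hY
  have e : (fun y ↦ 2 * (inner ℝ (X y) (S.φ y (Y y)) : ℝ)) =ᶠ[𝓝 x] fun y ↦
      mvfderiv I (fun y ↦ (inner ℝ (S.ξ y) (Y y) : ℝ)) y (X y)
      - mvfderiv I (fun y ↦ (inner ℝ (S.ξ y) (X y) : ℝ)) y (Y y)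
      - inner ℝ (S.ξ y) (mlieBracket I X Y y) := by
    filter_upwards [hX.eventually, hY.eventually] with y h1 h2 using S.two_mul_inner_φ h1 h2
  have eX {X : Π x : M, TangentSpace I x} (hX : SmoothNear I X x) :
      (fun y ↦ mvfderiv I (fun y ↦ (inner ℝ (S.ξ y) (X y) : ℝ)) y (S.ξ y)) =ᶠ[𝓝 x]
        fun y ↦ inner ℝ (S.ξ y) (mlieBracket I S.ξ X y) := by
    filter_upwards [hX.eventually] with y h1 using S.mvfderiv_ξ_inner_ξ h1
  have h := congrArg (fun L ↦ L (S.ξ x)) (mvfderiv_congr (I := I) e)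
  rw [mvfderiv_fun_sub ((hfY.mvfderiv hX).sub (hfX.mvfderiv hY)).mdiff (hξ.inner hXY).mdiff,
    mvfderiv_fun_sub (hfY.mvfderiv hX).mdiff (hfX.mvfderiv hY).mdiff, sub_apply, sub_apply,
    S.mvfderiv_ξ_inner_ξ hXY, mlieBracket_jacobi hξ hX hY, inner_add_right,
    mvfderiv_mul_apply mdifferentiableAt_const (hX.inner (S.smoothNear_φ hY)).mdiff,
    mvfderiv_const] at h
  have h1 := S.two_mul_inner_φ (hξ.mlieBracket hX) hY
  have h2 := S.two_mul_inner_φ hX (hξ.mlieBracket hY)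
  rw [mvfderiv_mlieBracket' hξ hX hfY, mvfderiv_congr (eX hY)] at h1
  rw [mvfderiv_mlieBracket' hξ hY hfX, mvfderiv_congr (eX hX)] at h2
  simp only [zero_apply, zero_mul, add_zero] at h
  linarith

theorem inner_nablaξ_add (u : TangentSpace I x) :
    (inner ℝ (S.nablaξ x u) u + inner ℝ (S.nablaξ x (S.φ x u)) (S.φ x u) : ℝ) = 0 := by
  obtain ⟨X, hX, rfl⟩ : ∃ X : Π x : M, TangentSpace I x, SmoothNear I X x ∧ X x = u :=
    ⟨_, smoothNear_extend I u, by simp⟩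
  have hξ := S.smoothNear_ξ x
  have hφ := S.smoothNear_φ hX
  have hf := hξ.inner hX
  have h := S.lieDerivative_dη hX hφ
  have e : (fun y ↦ (inner ℝ (X y) (S.φ y (S.φ y (X y))) : ℝ)) =
      fun y ↦ inner ℝ (S.ξ y) (X y) * inner ℝ (S.ξ y) (X y) - inner ℝ (X y) (X y) := by
    ext y
    rw [S.inner_φ_right, S.inner_φ_φ]
    ring
  have e2 : (fun y ↦ (inner ℝ (S.φ y (X y)) (S.φ y (X y)) : ℝ)) =
      fun y ↦ inner ℝ (X y) (X y) - inner ℝ (S.ξ y) (X y) * inner ℝ (S.ξ y) (X y) := by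
    ext y
    rw [S.inner_φ_φ]
  have h2 := mvfderiv_inner hξ.mdiff hφ.mdiff hφ.mdiff
  rw [e2, mvfderiv_fun_sub (hX.inner hX).mdiff (hf.mul hf).mdiff, sub_apply,
    mvfderiv_mul_apply hf.mdiff hf.mdiff, mvfderiv_inner hξ.mdiff hX.mdiff hX.mdiff,
    mvfderiv_inner hξ.mdiff hξ.mdiff hX.mdiff, S.nabla_ξ, S.nablaξ_ξ, inner_zero_left] at h2
  rw [e, mvfderiv_fun_sub (hf.mul hf).mdiff (hX.inner hX).mdiff, sub_apply,
    mvfderiv_mul_apply hf.mdiff hf.mdiff, mvfderiv_inner hξ.mdiff hX.mdiff hX.mdiff,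
    mvfderiv_inner hξ.mdiff hξ.mdiff hX.mdiff, S.nabla_ξ, S.nablaξ_ξ, inner_zero_left,
    nabla_torsion hξ.mdiff hX.mdiff, nabla_torsion hξ.mdiff hφ.mdiff, S.φ_φ, S.nabla_ξ, S.nabla_ξ,
    S.inner_φ_right, S.η_eq_inner] at h
  simp only [inner_sub_left, inner_sub_right, inner_add_right, inner_neg_right, inner_smul_right,
    S.inner_nablaξ_ξ] at h
  rw [real_inner_comm (nabla I S.ξ X x) (X x)] at h h2
  rw [real_inner_comm (nabla I S.ξ (fun y ↦ S.φ y (X y)) x)] at h2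
  rw [real_inner_comm (nabla I S.ξ (fun y ↦ S.φ y (X y)) x),
    real_inner_comm (S.nablaξ x (S.φ x (X x))), real_inner_comm (nabla I S.ξ X x) (S.ξ x)] at h
  rw [real_inner_comm (nabla I S.ξ X x) (S.ξ x)] at h2
  linarith

/-- The Reeb vector field is divergence free. -/
theorem sum_inner_nablaξ {e : Fin (Module.finrank ℝ E) → TangentSpace I x}
    (h : Orthonormal ℝ e) : ∑ i, (inner ℝ (S.nablaξ x (e i)) (e i) : ℝ) = 0 := by
  have tr (L : TangentSpace I x →ₗ[ℝ] TangentSpace I x) :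
      LinearMap.trace ℝ _ L = ∑ i, (inner ℝ (L (e i)) (e i) : ℝ) := by
    rw [L.trace_eq_sum_inner (orthonormalBasisOfFrame h)]
    simp [real_inner_comm]
  let A : TangentSpace I x →ₗ[ℝ] TangentSpace I x := S.nablaξ x
  let F : TangentSpace I x →ₗ[ℝ] TangentSpace I x := S.φ x
  have h1 : LinearMap.trace ℝ _ (F * (A * F)) = LinearMap.trace ℝ _ (A * F * F) :=
    LinearMap.trace_mul_comm ℝ F (A * F)
  rw [tr, tr] at h1
  have h2 i : (inner ℝ ((F * (A * F)) (e i)) (e i) : ℝ) =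
      -inner ℝ (S.nablaξ x (S.φ x (e i))) (S.φ x (e i)) := by
    rw [S.inner_φ_right, neg_neg]
    rfl
  have h3 i : (inner ℝ ((A * F * F) (e i)) (e i) : ℝ) = -inner ℝ (S.nablaξ x (e i)) (e i) := by
    have : (A * F * F) (e i) = S.nablaξ x (S.φ x (S.φ x (e i))) := rfl
    rw [this, S.φ_φ, map_add, map_neg, map_smul, S.nablaξ_ξ, smul_zero, add_zero, inner_neg_left]
  simp only [h2, h3, Finset.sum_neg_distrib] at h1
  have h4 := Finset.sum_eq_zero fun i (_ : i ∈ Finset.univ) ↦ S.inner_nablaξ_add (e i)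
  rw [Finset.sum_add_distrib] at h4
  linarith

variable {lam gam : M → ℝ}

theorem ricci_eq
    (hQ : ∀ (x : M) (u : TangentSpace I x),
      ricciOperator I u = lam x • u + (gam x * S.η x u) • S.ξ x) (u v : TangentSpace I x) :
    ricci I u v = lam x * inner ℝ u v + gam x * (inner ℝ (S.ξ x) u * inner ℝ (S.ξ x) v) := by
  rw [← inner_ricciOperator, hQ, inner_add_left, real_inner_smul_left, real_inner_smul_left,
    S.η_eq_inner]
  ring

theorem nablaRicci_eq (hlam : SmoothFunNear I lam x) (hgam : SmoothFunNear I gam x)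
    (hQ : ∀ (x : M) (u : TangentSpace I x),
      ricciOperator I u = lam x • u + (gam x * S.η x u) • S.ξ x)
    (hX : SmoothNear I X x) (hY : SmoothNear I Y x) (hZ : SmoothNear I Z x) :
    nablaRicci I X Y Z x = mvfderiv I lam x (X x) * inner ℝ (Y x) (Z x)
      + mvfderiv I gam x (X x) * (inner ℝ (S.ξ x) (Y x) * inner ℝ (S.ξ x) (Z x))
      + gam x * (inner ℝ (S.nablaξ x (X x)) (Y x) * inner ℝ (S.ξ x) (Z x)
        + inner ℝ (S.ξ x) (Y x) * inner ℝ (S.nablaξ x (X x)) (Z x)) := by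
  have hξ := S.smoothNear_ξ x
  have hfY := hξ.inner hY
  have hfZ := hξ.inner hZ
  simp only [nablaRicci, S.ricci_eq hQ]
  rw [mvfderiv_fun_add (hlam.mul (hY.inner hZ)).mdiff (hgam.mul (hfY.mul hfZ)).mdiff, add_apply,
    mvfderiv_mul_apply hlam.mdiff (hY.inner hZ).mdiff,
    mvfderiv_mul_apply hgam.mdiff (hfY.mul hfZ).mdiff, mvfderiv_mul_apply hfY.mdiff hfZ.mdiff,
    mvfderiv_inner hX.mdiff hY.mdiff hZ.mdiff, mvfderiv_inner hX.mdiff hξ.mdiff hY.mdiff,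
    mvfderiv_inner hX.mdiff hξ.mdiff hZ.mdiff]
  simp only [S.nabla_ξ]
  ring

/-- The contracted second Bianchi identity for a generalized Eta-Einstein structure. -/
theorem contractedBianchi_etaEinstein (hlam : SmoothFunNear I lam x)
    (hgam : SmoothFunNear I gam x)
    (hQ : ∀ (x : M) (u : TangentSpace I x),
      ricciOperator I u = lam x • u + (gam x * S.η x u) • S.ξ x) (u : TangentSpace I x) :
    (Module.finrank ℝ E - 2) * mvfderiv I lam x u + mvfderiv I gam x u =
      2 * mvfderiv I gam x (S.ξ x) * inner ℝ (S.ξ x) u := by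
  obtain ⟨X, hX, rfl⟩ : ∃ X : Π x : M, TangentSpace I x, SmoothNear I X x ∧ X x = u :=
    ⟨_, smoothNear_extend I u, by simp⟩
  obtain ⟨O, hO⟩ := exists_isOrthonormalFrameNear (I := I) x
  have ho := hO.orthonormal.self_of_nhds
  have h := contractedBianchi hO hX
  have hnorm i : (inner ℝ (O i x) (O i x) : ℝ) = 1 := by
    rw [real_inner_self_eq_norm_sq, ho.1 i, one_pow]
  have e1 : ∑ i, nablaRicci I X (O i) (O i) x =
      Module.finrank ℝ E * mvfderiv I lam x (X x) + mvfderiv I gam x (X x) := by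
    have a1 := sum_inner_mul_inner_frame ho (S.ξ x) (S.ξ x)
    have a2 := sum_inner_mul_inner_frame ho (S.nablaξ x (X x)) (S.ξ x)
    rw [S.unit_ξ] at a1
    rw [S.inner_nablaξ_ξ] at a2
    simp only [S.nablaRicci_eq hlam hgam hQ hX (hO.smooth _) (hO.smooth _), hnorm]
    simp only [real_inner_comm (S.ξ x), Finset.sum_add_distrib, ← Finset.mul_sum,
      mul_one, Finset.sum_const, Finset.card_univ, Fintype.card_fin, nsmul_eq_mul] at a1 a2 ⊢
    simp only [mul_comm (inner ℝ (S.ξ x) _) (inner ℝ (S.nablaξ x (X x)) _)]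
    rw [a1, a2]
    ring
  have e2 : ∑ i, nablaRicci I (O i) X (O i) x =
      mvfderiv I lam x (X x) + inner ℝ (S.ξ x) (X x) * mvfderiv I gam x (S.ξ x) := by
    have a (L : TangentSpace I x →L[ℝ] ℝ) (u : TangentSpace I x) :
        ∑ i, L (O i x) * inner ℝ u (O i x) = L u := by
      conv_rhs => rw [← sum_inner_smul_frame ho u]
      simp only [map_sum, map_smul, smul_eq_mul]
      exact Finset.sum_congr rfl fun i _ ↦ by rw [mul_comm, real_inner_comm]
    have a3 := a ((innerSL ℝ (X x)).comp (S.nablaξ x)) (S.ξ x)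
    simp only [ContinuousLinearMap.comp_apply, innerSL_apply_apply, S.nablaξ_ξ,
      inner_zero_right] at a3
    have e i : nablaRicci I (O i) X (O i) x =
        mvfderiv I lam x (O i x) * inner ℝ (X x) (O i x)
        + inner ℝ (S.ξ x) (X x) * (mvfderiv I gam x (O i x) * inner ℝ (S.ξ x) (O i x))
        + gam x * (inner ℝ (X x) (S.nablaξ x (O i x)) * inner ℝ (S.ξ x) (O i x))
        + gam x * inner ℝ (S.ξ x) (X x) * inner ℝ (S.nablaξ x (O i x)) (O i x) := by
      rw [S.nablaRicci_eq hlam hgam hQ (hO.smooth i) hX (hO.smooth i),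
        real_inner_comm (S.nablaξ x (O i x)) (X x)]
      ring
    simp only [e, Finset.sum_add_distrib, ← Finset.mul_sum, a, a3, S.sum_inner_nablaξ ho]
    ring
  rw [e1, e2] at h
  linarith

/-- If the differential of a function is `ρ` times the contact form, then `ρ` vanishes. -/
theorem eq_zero_of_mvfderiv_eq (hdim : 2 ≤ Module.finrank ℝ E) {F ρ : M → ℝ}
    (hF : SmoothFunNear I F x) (hρ : SmoothFunNear I ρ x)
    (h : ∀ (y : M) (u : TangentSpace I y), mvfderiv I F y u = ρ y * inner ℝ (S.ξ y) u) :
    ρ x = 0 := by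
  have := FiniteDimensional.complete ℝ E
  obtain ⟨v, hv, hv0⟩ : ∃ v : TangentSpace I x, inner ℝ (S.ξ x) v = (0 : ℝ) ∧ v ≠ 0 := by
    have hk : LinearMap.ker (innerₛₗ ℝ (S.ξ x)) ≠ ⊥ := by
      refine LinearMap.ker_ne_bot_of_finrank_lt ?_
      have : Module.finrank ℝ (TangentSpace I x) = Module.finrank ℝ E := rfl
      rw [Module.finrank_self]
      omega
    obtain ⟨v, hv, hv0⟩ := Submodule.exists_mem_ne_zero_of_ne_bot hk
    exact ⟨v, by simpa using hv, hv0⟩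
  have hX := smoothNear_extend I v
  have hXv : FiberBundle.extend E v x = v := by simp
  set X := FiberBundle.extend E v
  have hY := S.smoothNear_φ hX
  set Y : Π x : M, TangentSpace I x := fun y ↦ S.φ y (X y) with hYdef
  have hfX := (S.smoothNear_ξ x).inner hX
  have hfY := (S.smoothNear_ξ x).inner hY
  have hfY0 y : (inner ℝ (S.ξ y) (Y y) : ℝ) = 0 := S.inner_ξ_φ (X y)
  have b := mvfderiv_mlieBracket' hX hY hF
  have d := S.two_mul_inner_φ hX hY
  simp only [h] at b
  rw [mvfderiv_mul_apply hρ.mdiff hfY.mdiff, mvfderiv_mul_apply hρ.mdiff hfX.mdiff, hXv, hfY0,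
    hv] at b
  have e : (inner ℝ (X x) (S.φ x (Y x)) : ℝ) = -inner ℝ v v := by
    rw [hYdef, S.inner_φ_right, S.inner_φ_φ, hXv, hv]
    ring
  rw [e, hXv] at d
  have hvv : 0 < (inner ℝ v v : ℝ) := real_inner_self_pos.2 hv0
  have : ρ x * inner ℝ v v = 0 := by
    linear_combination (1 / 2 : ℝ) * b - (1 / 2 : ℝ) * ρ x * d
  exact (mul_eq_zero.1 this).resolve_right hvv.ne'

end ContactMetricStructure

end ContactGeometry

end

theorem mainTheorem4
    {E : Type*} [NormedAddCommGroup E] [NormedSpace ℝ E] [FiniteDimensional ℝ E]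
    {M : Type*} [TopologicalSpace M] [T2Space M] [SecondCountableTopology M]
    [ChartedSpace E M] [IsManifold 𝓘(ℝ, E) ∞ M]
    [RiemannianBundle (fun x : M ↦ TangentSpace 𝓘(ℝ, E) x)]
    [IsContMDiffRiemannianBundle 𝓘(ℝ, E) ∞ E (fun x : M ↦ TangentSpace 𝓘(ℝ, E) x)]
    (n : ℕ) (hn : 1 ≤ n) (hdim : Module.finrank ℝ E = 2 * n + 1)
    (S : ContactGeometry.ContactMetricStructure 𝓘(ℝ, E) n M)
    (lam gam : M → ℝ)
    (hlam : ContMDiff 𝓘(ℝ, E) 𝓘(ℝ, ℝ) ∞ lam)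
    (hgam : ContMDiff 𝓘(ℝ, E) 𝓘(ℝ, ℝ) ∞ gam)
    (hQ : ∀ (x : M) (u : TangentSpace 𝓘(ℝ, E) x),
      RiemannianGeometry.ricciOperator 𝓘(ℝ, E) u = lam x • u + (gam x * S.η x u) • S.ξ x) :
    (∀ x : M, mvfderiv 𝓘(ℝ, E) lam x (S.ξ x) = 0) ∧
    (∀ x : M, mvfderiv 𝓘(ℝ, E) gam x (S.ξ x) = 0) ∧
    (∀ x : M, (1 - 2 * (n : ℝ)) • mvfderiv 𝓘(ℝ, E) lam x = mvfderiv 𝓘(ℝ, E) gam x) ∧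
    (ConnectedSpace M →
      ((∃ c : ℝ, ∀ x : M, lam x = c) ↔ (∃ c : ℝ, ∀ x : M, gam x = c))) := by
  have hfin : ((Module.finrank ℝ E : ℕ) : ℝ) = 2 * n + 1 := by rw [hdim]; push_cast; ring
  have hn' : (1 : ℝ) ≤ n := by exact_mod_cast hn
  have sl (x : M) : RiemannianGeometry.SmoothFunNear 𝓘(ℝ, E) lam x :=
    Filter.Eventually.of_forall fun y ↦ hlam y
  have sg (x : M) : RiemannianGeometry.SmoothFunNear 𝓘(ℝ, E) gam x :=
    Filter.Eventually.of_forall fun y ↦ hgam y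
  have hB (x : M) (u : TangentSpace 𝓘(ℝ, E) x) :
      (2 * n - 1) * mvfderiv 𝓘(ℝ, E) lam x u + mvfderiv 𝓘(ℝ, E) gam x u =
        2 * mvfderiv 𝓘(ℝ, E) gam x (S.ξ x) * inner ℝ (S.ξ x) u := by
    have h := S.contractedBianchi_etaEinstein (sl x) (sg x) hQ u
    rw [hfin] at h
    linarith
  have hgξ (x : M) : mvfderiv 𝓘(ℝ, E) gam x (S.ξ x) = 0 := by
    have h := S.eq_zero_of_mvfderiv_eq (x := x) (by omega)
      (((RiemannianGeometry.smoothFunNear_const (2 * n - 1)).mul (sl x)).add (sg x))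
      ((RiemannianGeometry.smoothFunNear_const 2).mul ((sg x).mvfderiv (S.smoothNear_ξ x)))
      fun y u ↦ by
        rw [← hB y u, mvfderiv_fun_add
            ((RiemannianGeometry.smoothFunNear_const (2 * n - 1)).mul (sl y)).mdiff (sg y).mdiff,
          add_apply, RiemannianGeometry.mvfderiv_mul_apply mdifferentiableAt_const (sl y).mdiff,
          mvfderiv_const]
        simp
    linarith
  have hBu (x : M) (u : TangentSpace 𝓘(ℝ, E) x) :
      (1 - 2 * (n : ℝ)) * mvfderiv 𝓘(ℝ, E) lam x u = mvfderiv 𝓘(ℝ, E) gam x u := by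
    have h := hB x u
    rw [hgξ x] at h
    linarith
  have hne : 1 - 2 * (n : ℝ) ≠ 0 := by linarith
  refine ⟨fun x ↦ ?_, hgξ, fun x ↦ ?_, fun _ ↦ ⟨?_, ?_⟩⟩
  · have h := hBu x (S.ξ x)
    rw [hgξ x] at h
    exact (mul_eq_zero.1 h).resolve_left hne
  · ext u
    exact hBu x u
  · rintro ⟨c, hc⟩
    refine RiemannianGeometry.exists_eq_const_of_mvfderiv_eq_zero hgam fun x ↦ ?_
    ext u
    rw [← hBu x u, show lam = fun _ ↦ c from funext hc, mvfderiv_const]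
    simp
  · rintro ⟨c, hc⟩
    refine RiemannianGeometry.exists_eq_const_of_mvfderiv_eq_zero hlam fun x ↦ ?_
    ext u
    have h := hBu x u
    rw [show gam = fun _ ↦ c from funext hc, mvfderiv_const] at h
    exact (mul_eq_zero.1 h).resolve_left hne
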